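/- Let $\tilde{\mathbf G}\subset \mathrm{SL}_N$ be a semisimple $\mathbb Q$-subgroup (not necessarily connected; semisimple means that its radical is trivial), let $\tilde G=\tilde{\mathbf G}(\mathbb R)$, $\tilde{\mathfrak g}=\mathrm{Lie}(\tilde G)\subset\mathfrak{sl}_N(\mathbb R)$ and $\tilde{\mathfrak g}_{\mathbb Z}=\tilde{\mathfrak g}\cap\mathfrak{sl}_N(\mathbb Z)$. Fix a Euclidean norm $\|\cdot\|$ on $\mathrm{Mat}_N(\mathbb R)$. For a subspace $V\subset\tilde{\mathfrak g}$ let $V^\perp$ be its orthogonal complement with respect to the Killing form of $\tilde{\mathfrak g}$. A subalgebra $\mathfrak p$ of $\tilde{\mathfrak g}$ is called parabolic if $\mathfrak p\otimes\mathbb C$ contains a Borel (that is, maximal solvable) subalgebra of $\tilde{\mathfrak g}\otimes\mathbb C$. There are positive constants $\delta_0, C$, depending only on $\tilde{\mathbf G}$ (as a subgroup of $\mathrm{SL}_N$) and the norm, such that the following holds for every $0<\delta\le\delta_0$ (in particular for $\delta=\delta_0$). Let $g\in\tilde G$ be such that there is a nonzero vector $v\in\tilde{\mathfrak g}_{\mathbb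 Z}$ with $\|\mathrm{Ad}(g)v\|\le\delta$. Put $\Lambda=\mathrm{Ad}(g)\tilde{\mathfrak g}_{\mathbb Z}$ and let $\mathfrak v$ be the real Lie subalgebra of $\tilde{\mathfrak g}$ generated by $\{x\in\Lambda:\|x\|\le\delta^{1/C}\}$. Then: 1. $\mathfrak v$ is a nilpotent Lie algebra, and all its elements are nilpotent matrices. 2. The set $\{x\in\Lambda\cap\mathfrak v^\perp:\|x\|\le C\delta^{-1/C}\}$ spans $\mathfrak v^\perp$ over $\mathbb R$ and generates the group $\Lambda\cap\mathfrak v^\perp$. 3. The Lie subalgebra of $\tilde{\mathfrak g}$ generated by $\mathfrak v^\perp$ is a proper parabolic subalgebra of $\tilde{\mathfrak g}$. -/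

import Mathlib

open scoped DualNumber TensorProduct

/-! Matrices carry the commutator bracket. -/

attribute [local instance] LieRing.ofAssociativeRing

/-! ### Closed subschemes and Zariski-closed subsets of `SL_N` -/

/-- The `A`-points of the closed subscheme of `SL_N` over `k` cut out by the polynomials in `S`:
the matrices in `SL_N(A)` whose entries are a common zero of all `f ∈ S`. -/
def slZeroLocus {k : Type} [CommRing k] {N : ℕ} (S : Set (MvPolynomial (Fin N × Fin N) k))
    (A : Type) [CommRing A] [Algebra k A] : Set (Matrix.SpecialLinearGroup (Fin N) A) :=
  {g | ∀ f ∈ S,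
    MvPolynomial.aeval (fun ij : Fin N × Fin N => (g : Matrix (Fin N) (Fin N) A) ij.1 ij.2) f = 0}

/-- Zariski-closed subsets of `SL_N(ℂ)`. -/
def IsZariskiClosed {N : ℕ} (Z : Set (Matrix.SpecialLinearGroup (Fin N) ℂ)) : Prop :=
  ∃ S : Set (MvPolynomial (Fin N × Fin N) ℂ), Z = slZeroLocus S ℂ

/-- A subset of `SL_N(ℂ)` is Zariski-connected if it is nonempty and is not the union of two
disjoint nonempty relatively Zariski-closed subsets. -/
def IsZariskiConnected {N : ℕ} (H : Set (Matrix.SpecialLinearGroup (Fin N) ℂ)) : Prop :=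
  H.Nonempty ∧
  ∀ Z₁ Z₂ : Set (Matrix.SpecialLinearGroup (Fin N) ℂ), IsZariskiClosed Z₁ → IsZariskiClosed Z₂ →
    H ⊆ Z₁ ∪ Z₂ → H ∩ (Z₁ ∩ Z₂) = ∅ → H ⊆ Z₁ ∨ H ⊆ Z₂

/-! ### Algebraic subgroups of `SL_N` over `ℚ` -/

/-- A `ℚ`-subgroup of `SL_N`: a closed subscheme of `SL_N` over `ℚ`, given by its defining
polynomials, whose `A`-points form a subgroup of `SL_N(A)` for every commutative
`ℚ`-algebra `A`. -/
structure RatSubgroupSL (N : ℕ) where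
  /-- Defining equations, in the matrix entries. -/
  eqns : Set (MvPolynomial (Fin N × Fin N) ℚ)
  one_mem : ∀ (A : Type) [CommRing A] [Algebra ℚ A], 1 ∈ slZeroLocus eqns A
  mul_mem : ∀ (A : Type) [CommRing A] [Algebra ℚ A] (g h : Matrix.SpecialLinearGroup (Fin N) A),
    g ∈ slZeroLocus eqns A → h ∈ slZeroLocus eqns A → g * h ∈ slZeroLocus eqns A
  inv_mem : ∀ (A : Type) [CommRing A] [Algebra ℚ A] (g : Matrix.SpecialLinearGroup (Fin N) A),
    g ∈ slZeroLocus eqns A → g⁻¹ ∈ slZeroLocus eqns A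

namespace RatSubgroupSL

variable {N : ℕ} (G : RatSubgroupSL N)

/-- The group `G(A)` of `A`-points, as a subgroup of `SL_N(A)`. -/
def points (A : Type) [CommRing A] [Algebra ℚ A] :
    Subgroup (Matrix.SpecialLinearGroup (Fin N) A) where
  carrier := slZeroLocus G.eqns A
  one_mem' := G.one_mem A
  mul_mem' := fun {g h} hg hh => G.mul_mem A g h hg hh
  inv_mem' := fun {g} hg => G.inv_mem A g hg

/-- `G` is semisimple if its radical is trivial: the only Zariski-closed, Zariski-connected,
solvable, normal subgroup of `G(ℂ)` is the trivial group. (Connectedness of `G` is not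
required.) -/
def IsSemisimple : Prop :=
  ∀ H : Subgroup (Matrix.SpecialLinearGroup (Fin N) ℂ),
    H ≤ G.points ℂ → (H.subgroupOf (G.points ℂ)).Normal →
    IsZariskiClosed (H : Set (Matrix.SpecialLinearGroup (Fin N) ℂ)) →
    IsZariskiConnected (H : Set (Matrix.SpecialLinearGroup (Fin N) ℂ)) →
    Group.IsSolvable H → H = ⊥

/-! ### The Lie algebra -/

section LieAlg

variable {A B : Type} [CommRing A] [Algebra ℚ A] [CommRing B] [Algebra ℚ B]

theorem map_mem_points (φ : A →ₐ[ℚ] B) {g : Matrix.SpecialLinearGroup (Fin N) A}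
    (hg : g ∈ G.points A) : Matrix.SpecialLinearGroup.map (φ : A →+* B) g ∈ G.points B := by
  intro f hf
  have h := congrArg φ (hg f hf)
  rw [map_zero, MvPolynomial.comp_aeval_apply] at h
  exact h

theorem exists_of_map_eq (φ : A →ₐ[ℚ] B) (hφ : Function.Injective φ)
    {M : Matrix (Fin N) (Fin N) A} {g : Matrix.SpecialLinearGroup (Fin N) B}
    (hg : g ∈ G.points B) (hM : (g : Matrix (Fin N) (Fin N) B) = M.map φ) :
    ∃ h ∈ G.points A, (h : Matrix (Fin N) (Fin N) A) = M := by
  refine ⟨⟨M, ?_⟩, ?_, rfl⟩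
  · apply hφ
    have h1 := g.2
    have h2 := AlgHom.map_det φ M
    rw [AlgHom.mapMatrix_apply, ← hM, h1] at h2
    rw [h2, map_one]
  · intro f hf
    apply hφ
    have h := hg f hf
    rw [hM] at h
    rw [map_zero, MvPolynomial.comp_aeval_apply, ← h]
    rfl

/-- The matrix `1 + ε X` over the dual numbers `A[ε]`. -/
def onePlusEps (X : Matrix (Fin N) (Fin N) A) : Matrix (Fin N) (Fin N) A[ε] :=
  1 + (ε : A[ε]) • (TrivSqZeroExt.inlAlgHom A A A).mapMatrix X

/-- `X` is tangent to `G` at the identity: `1 + ε X ∈ G(A[ε])`. -/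
def IsTangent (X : Matrix (Fin N) (Fin N) A) : Prop :=
  ∃ g ∈ G.points A[ε], (g : Matrix (Fin N) (Fin N) A[ε]) = onePlusEps X

/-- The algebra homomorphism `A[ε] → B` extending `φ : A → B` and sending `ε` to `e`. -/
def dualLift (φ : A →ₐ[ℚ] B) (e : B) (he : e * e = 0) : A[ε] →ₐ[ℚ] B :=
  DualNumber.lift ⟨(φ, e), he, fun _ => Commute.all _ _⟩

theorem dualLift_eps (φ : A →ₐ[ℚ] B) (e : B) (he : e * e = 0) : dualLift φ e he ε = e := by
  simp [dualLift]

theorem dualLift_inl (φ : A →ₐ[ℚ] B) (e : B) (he : e * e = 0) (a : A) :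
    dualLift φ e he (TrivSqZeroExt.inl a) = φ a := by
  simp [dualLift]

theorem onePlusEps_map (φ : A →ₐ[ℚ] B) (e : B) (he : e * e = 0) (X : Matrix (Fin N) (Fin N) A) :
    (onePlusEps X).map (dualLift φ e he) = 1 + e • X.map φ := by
  rw [← AlgHom.mapMatrix_apply, onePlusEps, map_add, map_one]
  congr 1
  ext i j
  simp [dualLift_eps, dualLift_inl, TrivSqZeroExt.inlAlgHom]

theorem eps_mul_eps' {A : Type} [CommRing A] : (ε : A[ε]) * ε = 0 := DualNumber.eps_mul_eps

theorem eps_smul_sq {A : Type} [CommRing A] (c : A[ε]) : (c * ε) * (c * ε) = 0 := by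
  rw [mul_mul_mul_comm, eps_mul_eps', mul_zero]

theorem onePlusEps_mul {A : Type} [CommRing A] (X Y : Matrix (Fin N) (Fin N) A) :
    onePlusEps X * onePlusEps Y = onePlusEps (X + Y) := by
  simp only [onePlusEps, map_add, mul_add, add_mul, one_mul, mul_one, Matrix.smul_mul,
    Matrix.mul_smul, smul_smul, smul_add, eps_mul_eps', zero_smul]
  abel

theorem onePlusEps_zero {A : Type} [CommRing A] :
    onePlusEps (0 : Matrix (Fin N) (Fin N) A) = 1 := by
  simp [onePlusEps]

theorem isTangent_zero : G.IsTangent (0 : Matrix (Fin N) (Fin N) A) :=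
  ⟨1, (G.points _).one_mem, by rw [onePlusEps_zero]; rfl⟩

theorem IsTangent.add {X Y : Matrix (Fin N) (Fin N) A} (hX : G.IsTangent X) (hY : G.IsTangent Y) :
    G.IsTangent (X + Y) := by
  obtain ⟨g, hg, hgX⟩ := hX
  obtain ⟨h, hh, hhY⟩ := hY
  exact ⟨g * h, (G.points _).mul_mem hg hh, by
    rw [Matrix.SpecialLinearGroup.coe_mul, hgX, hhY, onePlusEps_mul]⟩

theorem IsTangent.smul {X : Matrix (Fin N) (Fin N) A} (c : A) (hX : G.IsTangent X) :
    G.IsTangent (c • X) := by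
  obtain ⟨g, hg, hgX⟩ := hX
  refine ⟨_, G.map_mem_points (dualLift (TrivSqZeroExt.inlAlgHom ℚ A A)
    (TrivSqZeroExt.inl c * ε) (eps_smul_sq _)) hg, ?_⟩
  · change (g : Matrix (Fin N) (Fin N) A[ε]).map _ = _
    rw [hgX]
    refine (onePlusEps_map _ _ (eps_smul_sq (TrivSqZeroExt.inl c)) X).trans ?_
    rw [onePlusEps]
    congr 1
    ext i j : 1
    have hc : c • X i j = c * X i j := rfl
    simp only [Matrix.smul_apply, Matrix.map_apply, AlgHom.mapMatrix_apply, hc,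
      TrivSqZeroExt.inlAlgHom_apply, TrivSqZeroExt.inl_mul, smul_eq_mul]
    ring

theorem IsTangent.map (φ : A →ₐ[ℚ] B) {X : Matrix (Fin N) (Fin N) A} (hX : G.IsTangent X) :
    G.IsTangent (X.map φ) := by
  obtain ⟨g, hg, hgX⟩ := hX
  refine ⟨_, G.map_mem_points (dualLift ((TrivSqZeroExt.inlAlgHom ℚ B B).comp φ)
    ε eps_mul_eps') hg, ?_⟩
  change (g : Matrix (Fin N) (Fin N) A[ε]).map _ = _
  rw [hgX]
  exact onePlusEps_map _ _ eps_mul_eps' X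

/-- Conjugation `X ↦ g X g⁻¹`. -/
theorem IsTangent.conj {X : Matrix (Fin N) (Fin N) A} (hX : G.IsTangent X)
    {g : Matrix.SpecialLinearGroup (Fin N) A} (hg : g ∈ G.points A) :
    G.IsTangent ((g : Matrix (Fin N) (Fin N) A) * X *
      ((g⁻¹ : Matrix.SpecialLinearGroup (Fin N) A) : Matrix (Fin N) (Fin N) A)) := by
  obtain ⟨x, hx, hxX⟩ := hX
  have h1 := G.map_mem_points (TrivSqZeroExt.inlAlgHom ℚ A A) hg
  have h2 := G.map_mem_points (TrivSqZeroExt.inlAlgHom ℚ A A) ((G.points A).inv_mem hg)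
  refine ⟨_, (G.points _).mul_mem ((G.points _).mul_mem h1 hx) h2, ?_⟩
  rw [Matrix.SpecialLinearGroup.coe_mul, Matrix.SpecialLinearGroup.coe_mul, hxX]
  have e : ∀ k : Matrix.SpecialLinearGroup (Fin N) A,
      ((Matrix.SpecialLinearGroup.map
        ((TrivSqZeroExt.inlAlgHom ℚ A A : A →ₐ[ℚ] A[ε]) : A →+* A[ε]) k :
        Matrix.SpecialLinearGroup (Fin N) A[ε]) : Matrix (Fin N) (Fin N) A[ε]) =
      (TrivSqZeroExt.inlAlgHom A A A).mapMatrix (k : Matrix (Fin N) (Fin N) A) := fun k => rfl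
  rw [e, e, onePlusEps, onePlusEps, mul_add, add_mul, mul_one, ← map_mul,
    ← Matrix.SpecialLinearGroup.coe_mul, mul_inv_cancel, Matrix.SpecialLinearGroup.coe_one,
    map_one, Matrix.mul_smul, Matrix.smul_mul, ← map_mul, ← map_mul]

theorem isTangent_of_eps {X : Matrix (Fin N) (Fin N) A}
    {z : Matrix.SpecialLinearGroup (Fin N) (A[ε])[ε]} (hz : z ∈ G.points (A[ε])[ε])
    (hzX : (z : Matrix (Fin N) (Fin N) (A[ε])[ε]) =
      onePlusEps ((ε : A[ε]) • X.map (TrivSqZeroExt.inlAlgHom ℚ A A))) : G.IsTangent X := by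
  let φ₀ : A →ₐ[ℚ] (A[ε])[ε] :=
    (TrivSqZeroExt.inlAlgHom ℚ A[ε] A[ε]).comp (TrivSqZeroExt.inlAlgHom ℚ A A)
  have he := eps_smul_sq (A := A[ε]) (TrivSqZeroExt.inl (ε : A[ε]))
  let ψ : A[ε] →ₐ[ℚ] (A[ε])[ε] := dualLift (A := A) (B := (A[ε])[ε]) φ₀ _ he
  refine G.exists_of_map_eq ψ ?_ hz ?_
  · intro a b hab
    have hval : ∀ a : A[ε], ψ a =
        TrivSqZeroExt.inl (TrivSqZeroExt.inl a.fst) +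
          TrivSqZeroExt.inl (TrivSqZeroExt.inl a.snd) *
            (TrivSqZeroExt.inl (ε : A[ε]) * (ε : (A[ε])[ε])) := by
      intro a
      simp [ψ, dualLift, DualNumber.lift_apply_apply, φ₀]
    rw [hval, hval] at hab
    refine TrivSqZeroExt.ext ?_ ?_
    · have := congrArg (fun t : (A[ε])[ε] => t.fst.fst) hab
      simpa using this
    · have := congrArg (fun t : (A[ε])[ε] => t.snd.snd) hab
      simpa using this
  · rw [hzX]
    have h := onePlusEps_map φ₀ (TrivSqZeroExt.inl (ε : A[ε]) * (ε : (A[ε])[ε])) he X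
    have h' : (onePlusEps X).map ψ = 1 + (TrivSqZeroExt.inl (ε : A[ε]) * (ε : (A[ε])[ε])) •
      X.map φ₀ := h
    rw [h', onePlusEps]
    congr 1
    refine Matrix.ext fun i j => ?_
    change (ε : (A[ε])[ε]) * TrivSqZeroExt.inl ((ε : A[ε]) * TrivSqZeroExt.inl (X i j)) =
      (TrivSqZeroExt.inl (ε : A[ε]) * (ε : (A[ε])[ε])) *
        TrivSqZeroExt.inl (TrivSqZeroExt.inl (X i j))
    rw [TrivSqZeroExt.inl_mul, ← mul_assoc, mul_comm (ε : (A[ε])[ε])]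

theorem IsTangent.lie {X Y : Matrix (Fin N) (Fin N) A} (hX : G.IsTangent X)
    (hY : G.IsTangent Y) : G.IsTangent ⁅X, Y⁆ := by
  obtain ⟨x, hx, hxX⟩ := hX
  have hY' := hY.map G (TrivSqZeroExt.inlAlgHom ℚ A A)
  have hxinv : ((x⁻¹ : Matrix.SpecialLinearGroup (Fin N) A[ε]) : Matrix (Fin N) (Fin N) A[ε]) =
      onePlusEps (-X) := by
    have h1 : (x : Matrix (Fin N) (Fin N) A[ε]) * onePlusEps (-X) = 1 := by
      rw [hxX, onePlusEps_mul, add_neg_cancel, onePlusEps_zero]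
    have h2 : ((x⁻¹ : Matrix.SpecialLinearGroup (Fin N) A[ε]) : Matrix (Fin N) (Fin N) A[ε]) *
        (x : Matrix (Fin N) (Fin N) A[ε]) = 1 := by
      rw [← Matrix.SpecialLinearGroup.coe_mul, inv_mul_cancel, Matrix.SpecialLinearGroup.coe_one]
    exact left_inv_eq_right_inv h2 h1
  have hc := (hY'.conj G hx).add G (hY'.smul G (-1))
  have key : (x : Matrix (Fin N) (Fin N) A[ε]) * Y.map (TrivSqZeroExt.inlAlgHom ℚ A A) *
      ((x⁻¹ : Matrix.SpecialLinearGroup (Fin N) A[ε]) : Matrix (Fin N) (Fin N) A[ε]) +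
      (-1 : A[ε]) • Y.map (TrivSqZeroExt.inlAlgHom ℚ A A) =
      (ε : A[ε]) • (⁅X, Y⁆).map (TrivSqZeroExt.inlAlgHom ℚ A A) := by
    have e : ∀ M : Matrix (Fin N) (Fin N) A, M.map (TrivSqZeroExt.inlAlgHom ℚ A A) =
      (TrivSqZeroExt.inlAlgHom A A A).mapMatrix M := fun M => rfl
    rw [hxinv, hxX, e, e, onePlusEps, onePlusEps, Ring.lie_def, map_sub, map_mul, map_mul, map_neg]
    generalize (TrivSqZeroExt.inlAlgHom A A A).mapMatrix X = X'
    generalize (TrivSqZeroExt.inlAlgHom A A A).mapMatrix Y = Y'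
    simp only [mul_add, add_mul, one_mul, mul_one, Matrix.smul_mul, mul_neg, neg_smul, smul_neg,
      Matrix.mul_smul, smul_smul, smul_sub, eps_mul_eps', zero_smul, one_smul]
    abel
  rw [key] at hc
  obtain ⟨z, hz, hzZ⟩ := hc
  exact G.isTangent_of_eps hz hzZ

end LieAlg

/-- The Lie algebra `Lie(G)(A)`, a Lie subalgebra of the `N × N` matrices over `A` with the
commutator bracket (its elements have trace zero, since `det (1 + ε X) = 1 + ε tr X`).
For `A = ℝ` this is the Lie algebra of the Lie group `G(ℝ)`. -/
def lieAlgebra (A : Type) [CommRing A] [Algebra ℚ A] :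
    LieSubalgebra A (Matrix (Fin N) (Fin N) A) where
  carrier := {X | G.IsTangent X}
  zero_mem' := G.isTangent_zero
  add_mem' := fun {_ _} hX hY => hX.add G hY
  smul_mem' := fun c _ hX => hX.smul G c
  lie_mem' := fun {_ _} hX hY => hX.lie G hY

/-- The adjoint action `Ad(g) X = g X g⁻¹` of `g ∈ G(ℝ)` on `Lie(G)(ℝ)`. -/
noncomputable def Ad (g : G.points ℝ) : G.lieAlgebra ℝ →ₗ[ℝ] G.lieAlgebra ℝ where
  toFun X := ⟨(g.1 : Matrix (Fin N) (Fin N) ℝ) * (X : Matrix (Fin N) (Fin N) ℝ) *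
    ((g.1⁻¹ : Matrix.SpecialLinearGroup (Fin N) ℝ) : Matrix (Fin N) (Fin N) ℝ),
    IsTangent.conj G X.2 g.2⟩
  map_add' X Y := Subtype.ext (by simp [mul_add, add_mul])
  map_smul' c X := Subtype.ext (by simp)

/-- The integral lattice of `Lie(G)(ℝ)`: its elements with integer entries. -/
noncomputable def intLattice : AddSubgroup (G.lieAlgebra ℝ) where
  carrier := {X | ∃ Z : Matrix (Fin N) (Fin N) ℤ,
    (X : Matrix (Fin N) (Fin N) ℝ) = Z.map (fun n : ℤ => (n : ℝ))}
  zero_mem' := ⟨0, by ext; simp⟩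
  add_mem' := by
    rintro X Y ⟨Z, hZ⟩ ⟨W, hW⟩
    exact ⟨Z + W, by rw [AddMemClass.coe_add, hZ, hW]; ext; simp⟩
  neg_mem' := by
    rintro X ⟨Z, hZ⟩
    exact ⟨-Z, by rw [NegMemClass.coe_neg, hZ]; ext; simp⟩

/-- The lattice `Ad(g) Lie(G)_ℤ` in `Lie(G)(ℝ)`. -/
noncomputable def latticeAt (g : G.points ℝ) : AddSubgroup (G.lieAlgebra ℝ) :=
  G.intLattice.map (G.Ad g).toAddMonoidHom

/-- The Euclidean norm `‖X‖ = √(q X)` on `Lie(G)(ℝ)` induced by a (positive definite) quadratic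
form `q` on the space of all real `N × N` matrices. -/
noncomputable def euclNorm (q : QuadraticForm ℝ (Matrix (Fin N) (Fin N) ℝ))
    (X : G.lieAlgebra ℝ) : ℝ :=
  Real.sqrt (q (X : Matrix (Fin N) (Fin N) ℝ))

/-- The real Lie subalgebra of `Lie(G)(ℝ)` generated by the vectors `Ad(g) w`, `w` integral, of
norm at most `r`. -/
noncomputable def shortSubalgebra (q : QuadraticForm ℝ (Matrix (Fin N) (Fin N) ℝ)) (g : G.points ℝ) (r : ℝ) :
    LieSubalgebra ℝ (G.lieAlgebra ℝ) :=
  LieSubalgebra.lieSpan ℝ (G.lieAlgebra ℝ) {x | x ∈ G.latticeAt g ∧ G.euclNorm q x ≤ r}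

end RatSubgroupSL

/-! ### Killing-orthogonal complements and parabolic subalgebras -/

/-- The orthogonal complement of a subspace with respect to the Killing form. -/
noncomputable def killingPerp {L : Type} [LieRing L] [LieAlgebra ℝ L] (V : Submodule ℝ L) :
    Submodule ℝ L :=
  LinearMap.BilinForm.orthogonal (killingForm ℝ L) V

/-- A Borel subalgebra of a complex Lie algebra: a maximal solvable subalgebra. -/
def IsBorelSubalgebra {L : Type} [LieRing L] [LieAlgebra ℂ L] (b : LieSubalgebra ℂ L) : Prop :=
  Maximal (fun s : LieSubalgebra ℂ L => LieAlgebra.IsSolvable s) b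

/-- A subalgebra `p` of a real Lie algebra `L` is parabolic if its complexification contains a
Borel subalgebra of the complexification of `L`. -/
def IsParabolicSubalgebra {L : Type} [LieRing L] [LieAlgebra ℝ L] (p : LieSubalgebra ℝ L) : Prop :=
  ∃ b : LieSubalgebra ℂ (ℂ ⊗[ℝ] L), IsBorelSubalgebra b ∧
    b.toSubmodule ≤ p.toSubmodule.baseChange ℂ

/-! ### Rational structures -/

/-! Write `r = δ ^ (1 / C)`, let `S` be the set of lattice vectors of length at most `r`, and let
`n` be the dimension of the Lie algebra.

Nilpotency. The lattice is closed under brackets, and for small `r` the bracket of two vectors of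
`S` is again of length at most `r`. Hence `S` is closed under brackets and 𝔳 is just its linear
span. A matrix product of vectors of `S` is conjugate, by the same `g`, to an integer matrix and
still has length at most `r`, so its trace is an integer of absolute value less than 1, that is, 0.
Thus all powers of an element of the span of `S` have trace zero, which forces nilpotency
(`isNilpotent_of_mem_span_short`), and Engel's theorem does the rest.

Generators of the orthogonal lattice. The Killing form is integral on the lattice, and its
discriminant `d` does not depend on `g`. By a transference argument
(`le_closure_short_of_dual_bound`) a discrete group is generated by vectors of length `O(R)` once
every functional that is integral and nonzero on it has norm at least `1 / R`. Such a functional on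
the lattice points of 𝔳^⊥ extends to an integral functional on the whole lattice. Up to the factor
`d` the latter is pairing with a lattice vector outside 𝔳, and Dirichlet approximation
(`le_mul_of_notMem_span_short`) shows that such a vector stays at distance at least a multiple of
`r` from 𝔳. So `R` is of order `1 / r` (`exists_forall_orthogonal_le_closure`).

Parabolicity. A Borel subalgebra containing 𝔳 ⊗ ℂ acts by triangular matrices in which 𝔳 is strictly
triangular, so it is Killing-orthogonal to 𝔳 and lies in 𝔳^⊥ ⊗ ℂ
(`isParabolicSubalgebra_of_killingPerp_le`).

Properness. Bracketing the given vector of length at most `δ = r ^ C` with a generator of 𝔳^⊥ costs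
a factor `O(1 / r)`. As `C ≥ n + 2`, all brackets of depth at most `n` still lie in 𝔳. By dimension
their span stabilises within `n` steps. Were the generated subalgebra everything, this span would be
a nonzero ideal inside the nilpotent 𝔳, against the triviality of the radical
(`lieSpan_ne_top_of_forall_lie_mem`).

That the Lie algebra has trivial radical is deduced from the hypothesis on the group: the
exponentials of an `Ad`-stable abelian ideal form a commutative group whose Zariski closure is
closed, connected, normal and commutative, hence trivial (`eq_bot_of_isLieAbelian`). -/

theorem mem_span_algebraMap_of_forall_sum_eq_zero {k K ι : Type*} [Field k] [Field K]
    [Algebra k K] [Fintype ι] (E : Set (ι → k)) (x : ι → K)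
    (hx : ∀ a ∈ E, ∑ i, algebraMap k K (a i) * x i = 0) :
    x ∈ Submodule.span K {z : ι → K | ∃ y : ι → k, (∀ a ∈ E, ∑ i, a i * y i = 0) ∧
      z = fun i => algebraMap k K (y i)} := by
  classical
  -- Expand the entries of `x` in a `k`-basis of `K`. The equations have coefficients in `k`, so
  -- each coordinate vector satisfies them separately.
  let e := Module.Basis.ofVectorSpace k K
  let s := Finset.univ.biUnion fun i => (e.repr (x i)).support
  have hsum : x = ∑ j ∈ s, e j • (fun i => algebraMap k K (e.repr (x i) j)) := by
    funext i
    conv_lhs => rw [← e.linearCombination_repr (x i), Finsupp.linearCombination_apply]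
    rw [Finsupp.sum_of_support_subset (s := s) _ ?_ _ (by simp)]
    · simp [Finset.sum_apply, Algebra.smul_def, mul_comm]
    · intro j hj
      exact Finset.mem_biUnion.2 ⟨i, Finset.mem_univ _, hj⟩
  rw [hsum]
  refine Submodule.sum_mem _ fun j _ => Submodule.smul_mem _ _ (Submodule.subset_span
    ⟨fun i => e.repr (x i) j, fun a ha => ?_, rfl⟩)
  have h := congrArg (fun z => e.repr z j) (hx a ha)
  simpa [← Algebra.smul_def] using h

/-- First-order Taylor expansion, exact because `ε² = 0`. It turns statements about points over dual
numbers into statements about differentials. -/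
theorem aeval_inl_add_inr {k σ A : Type*} [CommRing k] [CommRing A] [Algebra k A] [Fintype σ]
    (x y : σ → A) (f : MvPolynomial σ k) :
    MvPolynomial.aeval (fun i => (TrivSqZeroExt.inl (x i) + TrivSqZeroExt.inr (y i) : A[ε])) f =
      TrivSqZeroExt.inl (MvPolynomial.aeval x f) +
        TrivSqZeroExt.inr (∑ i, MvPolynomial.aeval x (MvPolynomial.pderiv i f) * y i) := by
  classical
  induction f using MvPolynomial.induction_on with
  | C a => simp [TrivSqZeroExt.algebraMap_eq_inl']
  | add p q hp hq =>
    simp only [map_add, hp, hq, TrivSqZeroExt.inl_add, add_mul, Finset.sum_add_distrib,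
      TrivSqZeroExt.inr_add]
    abel
  | mul_X p n hp =>
    have h : ∑ i, MvPolynomial.aeval x (MvPolynomial.pderiv i (p * MvPolynomial.X n)) * y i =
        MvPolynomial.aeval x p * y n +
          (∑ i, MvPolynomial.aeval x (MvPolynomial.pderiv i p) * y i) * x n := by
      simp only [Derivation.leibniz, MvPolynomial.pderiv_X, smul_eq_mul, map_add, map_mul,
        MvPolynomial.aeval_X, add_mul, Finset.sum_add_distrib]
      congr 1
      · rw [Finset.sum_eq_single n] <;> simp +contextual [eq_comm]
      · rw [Finset.sum_mul]
        exact Finset.sum_congr rfl fun i _ => by ring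
    rw [map_mul, hp, MvPolynomial.aeval_X, h, map_mul, MvPolynomial.aeval_X]
    refine TrivSqZeroExt.ext ?_ ?_
    · simp
    · simp [mul_comm, add_comm]

/-! ### The tangent space as the solution space of rational linear equations -/

namespace RatSubgroupSL

variable {N : ℕ} (G : RatSubgroupSL N)

section

variable {A : Type} [CommRing A] [Algebra ℚ A]

theorem onePlusEps_apply {A : Type} [CommRing A] (X : Matrix (Fin N) (Fin N) A) (i j : Fin N) :
    onePlusEps X i j = TrivSqZeroExt.inl ((1 : Matrix (Fin N) (Fin N) A) i j) +
      TrivSqZeroExt.inr (X i j) := by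
  refine TrivSqZeroExt.ext ?_ ?_
  · by_cases h : i = j <;> simp [onePlusEps, Matrix.one_apply, h, TrivSqZeroExt.inlAlgHom]
  · by_cases h : i = j <;> simp [onePlusEps, Matrix.one_apply, h, TrivSqZeroExt.inlAlgHom]

theorem det_onePlusEps {A : Type} [CommRing A] (X : Matrix (Fin N) (Fin N) A) :
    (onePlusEps X).det = 1 + TrivSqZeroExt.inr X.trace := by
  rw [onePlusEps, Matrix.det_one_add_smul, pow_two, eps_mul_eps', mul_zero, add_zero]
  congr 1
  rw [AlgHom.mapMatrix_apply, ← AddMonoidHom.map_trace]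
  refine TrivSqZeroExt.ext ?_ ?_ <;> simp [TrivSqZeroExt.inlAlgHom]

/-- The differential at the identity of a polynomial in the matrix entries. -/
noncomputable def diffOne (f : MvPolynomial (Fin N × Fin N) ℚ) : Fin N × Fin N → ℚ := fun ij =>
  MvPolynomial.eval (fun kl => (1 : Matrix (Fin N) (Fin N) ℚ) kl.1 kl.2) (MvPolynomial.pderiv ij f)

theorem aeval_one_eq (f : MvPolynomial (Fin N × Fin N) ℚ) :
    MvPolynomial.aeval (fun kl => (1 : Matrix (Fin N) (Fin N) A) kl.1 kl.2) f =
      algebraMap ℚ A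
        (MvPolynomial.eval (fun kl => (1 : Matrix (Fin N) (Fin N) ℚ) kl.1 kl.2) f) := by
  rw [← MvPolynomial.coe_aeval_eq_eval]
  refine Eq.trans ?_ (MvPolynomial.aeval_algebraMap_apply A
    (fun kl : Fin N × Fin N => (1 : Matrix (Fin N) (Fin N) ℚ) kl.1 kl.2) f)
  congr 2
  funext kl
  by_cases h : kl.1 = kl.2 <;> simp [Matrix.one_apply, h]

/-- The constant terms of the equations vanish because `1` is a point of `G`, so only the linear
terms at `1` and the trace (from `det = 1`) remain. These have rational coefficients, so the Lie
algebra is defined over `ℚ`. -/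
theorem isTangent_iff (X : Matrix (Fin N) (Fin N) A) :
    G.IsTangent X ↔ (∀ f ∈ G.eqns, ∑ ij, algebraMap ℚ A (diffOne f ij) * X ij.1 ij.2 = 0) ∧
      ∑ ij : Fin N × Fin N, algebraMap ℚ A ((1 : Matrix (Fin N) (Fin N) ℚ) ij.1 ij.2) *
        X ij.1 ij.2 = 0 := by
  have key : ∀ f ∈ G.eqns, MvPolynomial.aeval (fun ij => onePlusEps X ij.1 ij.2) f =
      TrivSqZeroExt.inr (∑ ij, algebraMap ℚ A (diffOne f ij) * X ij.1 ij.2) := by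
    intro f hf
    have h1 := G.one_mem A f hf
    simp only [onePlusEps_apply]
    rw [aeval_inl_add_inr (fun ij : Fin N × Fin N => (1 : Matrix (Fin N) (Fin N) A) ij.1 ij.2)
      (fun ij : Fin N × Fin N => X ij.1 ij.2)]
    rw [Matrix.SpecialLinearGroup.coe_one] at h1
    simp only [h1, aeval_one_eq, TrivSqZeroExt.inl_zero, zero_add]
    rfl
  have htr : ∑ ij : Fin N × Fin N, algebraMap ℚ A ((1 : Matrix (Fin N) (Fin N) ℚ) ij.1 ij.2) *
        X ij.1 ij.2 = X.trace := by
    rw [Fintype.sum_prod_type]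
    simp only [Matrix.trace, Matrix.diag]
    refine Finset.sum_congr rfl fun i _ => ?_
    rw [Finset.sum_eq_single i] <;> simp +contextual [eq_comm]
  have hinr : ∀ a : A, (TrivSqZeroExt.inr a : A[ε]) = 0 ↔ a = 0 := fun a =>
    ⟨fun h => by simpa using congrArg TrivSqZeroExt.snd h, fun h => by rw [h]; simp⟩
  rw [htr]
  constructor
  · rintro ⟨g, hg, hgX⟩
    constructor
    · intro f hf
      have h := hg f hf
      rw [hgX, key f hf] at h
      exact (hinr _).1 h
    · have h := g.2
      rw [hgX, det_onePlusEps] at h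
      exact (hinr _).1 (by simpa using h)
  · rintro ⟨h1, h2⟩
    refine ⟨⟨onePlusEps X, by rw [det_onePlusEps, h2]; simp⟩, fun f hf => ?_, rfl⟩
    exact (key f hf).trans (by rw [h1 f hf]; simp)

/-- The Lie algebra over a field `K` is spanned by the Lie algebra over a subfield `k`. -/
theorem mem_span_of_isTangent {k K : Type} [Field k] [Field K] [Algebra ℚ k] [Algebra ℚ K]
    [Algebra k K] {X : Matrix (Fin N) (Fin N) K} (hX : G.IsTangent X) :
    X ∈ Submodule.span K {Z | ∃ Y : Matrix (Fin N) (Fin N) k, G.IsTangent Y ∧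
      Z = Y.map (algebraMap k K)} := by
  have hQ : ∀ c : ℚ, algebraMap ℚ K c = algebraMap k K (algebraMap ℚ k c) := fun c => by simp
  let coef : (Fin N × Fin N → ℚ) → (Fin N × Fin N → k) := fun a ij => algebraMap ℚ k (a ij)
  let E : Set (Fin N × Fin N → k) := coef '' (diffOne '' G.eqns ∪
    {fun ij => (1 : Matrix (Fin N) (Fin N) ℚ) ij.1 ij.2})
  have hE : ∀ Y : Matrix (Fin N) (Fin N) k, (∀ a ∈ E, ∑ ij, a ij * Y ij.1 ij.2 = 0) →
      G.IsTangent Y := by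
    intro Y hY
    rw [isTangent_iff]
    exact ⟨fun f hf => hY _ ⟨_, Or.inl ⟨f, hf, rfl⟩, rfl⟩, hY _ ⟨_, Or.inr rfl, rfl⟩⟩
  have h := mem_span_algebraMap_of_forall_sum_eq_zero E (fun ij => X ij.1 ij.2) (by
    rw [isTangent_iff] at hX
    rintro _ ⟨a, ⟨f, hf, rfl⟩ | rfl, rfl⟩
    · simpa only [coef, ← hQ] using hX.1 f hf
    · simpa only [coef, ← hQ] using hX.2)
  let Φ : (Fin N × Fin N → K) →ₗ[K] Matrix (Fin N) (Fin N) K :=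
    { toFun := fun z => Matrix.of fun i j => z (i, j)
      map_add' := fun _ _ => rfl
      map_smul' := fun _ _ => rfl }
  have h2 := Submodule.mem_map_of_mem (f := Φ) h
  rw [Submodule.map_span] at h2
  refine Submodule.span_mono ?_ h2
  rintro _ ⟨_, ⟨y, hy, rfl⟩, rfl⟩
  exact ⟨Matrix.of fun i j => y (i, j), hE _ hy, rfl⟩

end

end RatSubgroupSL

/-! ### One-parameter subgroups of `G(ℂ)` -/

theorem hasDerivAt_eval_mvPolynomial {σ : Type*} [Fintype σ] {c : ℂ → σ → ℂ} {c' : σ → ℂ} {t : ℂ}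
    (hc : ∀ i, HasDerivAt (fun s => c s i) (c' i) t) (f : MvPolynomial σ ℂ) :
    HasDerivAt (fun s => MvPolynomial.eval (c s) f)
      (∑ i, MvPolynomial.eval (c t) (MvPolynomial.pderiv i f) * c' i) t := by
  classical
  induction f using MvPolynomial.induction_on with
  | C a => simpa using hasDerivAt_const t a
  | add p q hp hq =>
    simp only [map_add, add_mul, Finset.sum_add_distrib]
    exact hp.add hq
  | mul_X p n hp =>
    have h := hp.mul (hc n)
    simp only [map_mul, MvPolynomial.eval_X]
    refine h.congr_deriv ?_
    simp only [Derivation.leibniz, MvPolynomial.pderiv_X, smul_eq_mul, map_add, map_mul,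
      MvPolynomial.eval_X, add_mul, Finset.sum_add_distrib]
    rw [add_comm]
    congr 1
    · rw [Finset.sum_eq_single n] <;> simp +contextual [eq_comm]
    · rw [Finset.sum_mul]
      exact Finset.sum_congr rfl fun i _ => by ring

section

attribute [local instance] Matrix.linftyOpNormedRing Matrix.linftyOpNormedAlgebra

theorem hasDerivAt_matrix_exp_apply {N : ℕ} (X : Matrix (Fin N) (Fin N) ℂ) (t : ℂ) (i j : Fin N) :
    HasDerivAt (fun s : ℂ => NormedSpace.exp (s • X) i j)
      ((NormedSpace.exp (t • X) * X) i j) t := by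
  have h := hasDerivAt_exp_smul_const (𝕂 := ℂ) X t
  let φ : Matrix (Fin N) (Fin N) ℂ →L[ℂ] ℂ :=
    LinearMap.toContinuousLinearMap (Matrix.entryLinearMap ℂ ℂ i j)
  exact (φ.hasFDerivAt.comp_hasDerivAt t h)

end

/-- The evaluation point of polynomials attached to a matrix. -/
def matrixPoint {N : ℕ} {A : Type} (M : Matrix (Fin N) (Fin N) A) : Fin N × Fin N → A :=
  fun ij => M ij.1 ij.2

/-- The invariant derivation `f ↦ (M ↦ df_M (M X))` on polynomials in the matrix entries. -/
noncomputable def invariantDeriv {N : ℕ} (X : Matrix (Fin N) (Fin N) ℂ)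
    (f : MvPolynomial (Fin N × Fin N) ℂ) : MvPolynomial (Fin N × Fin N) ℂ :=
  ∑ ij : Fin N × Fin N, MvPolynomial.pderiv ij f *
    ∑ k, MvPolynomial.X (ij.1, k) * MvPolynomial.C (X k ij.2)

theorem aeval_invariantDeriv {N : ℕ} {A : Type} [CommRing A] [Algebra ℂ A]
    (X : Matrix (Fin N) (Fin N) ℂ) (f : MvPolynomial (Fin N × Fin N) ℂ)
    (M : Matrix (Fin N) (Fin N) A) :
    MvPolynomial.aeval (matrixPoint M) (invariantDeriv X f) =
      ∑ ij, MvPolynomial.aeval (matrixPoint M) (MvPolynomial.pderiv ij f) *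
        matrixPoint (M * X.map (algebraMap ℂ A)) ij := by
  simp [invariantDeriv, matrixPoint, Matrix.mul_apply]

namespace RatSubgroupSL

variable {N : ℕ} (G : RatSubgroupSL N)

/-- `f` vanishes identically on the scheme `G ⊗ ℂ`. -/
def VanishesOn (f : MvPolynomial (Fin N × Fin N) ℂ) : Prop :=
  ∀ (A : Type) [CommRing A] [Algebra ℚ A] [Algebra ℂ A], ∀ g ∈ G.points A,
    MvPolynomial.aeval (matrixPoint (g : Matrix (Fin N) (Fin N) A)) f = 0

variable {G}

/-- Evaluate `f` at the `A[ε]`-point `g (1 + ε X)`: the coefficient of `ε` is the invariant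
derivative at `g`. Vanishing on points over all algebras, nilpotents included, is what makes the
property pass to derivatives without assuming that the scheme is reduced. -/
theorem VanishesOn.invariantDeriv {X : Matrix (Fin N) (Fin N) ℂ} (hX : G.IsTangent X)
    {f : MvPolynomial (Fin N × Fin N) ℂ} (hf : G.VanishesOn f) :
    G.VanishesOn (invariantDeriv X f) := by
  intro A _ _ _ g hg
  obtain ⟨x, hx, hxX⟩ := hX.map G (RingHom.toRatAlgHom (algebraMap ℂ A))
  have hg' := G.map_mem_points (TrivSqZeroExt.inlAlgHom ℚ A A) hg
  have h := hf A[ε] _ ((G.points _).mul_mem hg' hx)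
  have e : matrixPoint (((Matrix.SpecialLinearGroup.map
      ((TrivSqZeroExt.inlAlgHom ℚ A A : A →ₐ[ℚ] A[ε]) : A →+* A[ε]) g * x :
      Matrix.SpecialLinearGroup (Fin N) A[ε]) : Matrix (Fin N) (Fin N) A[ε])) =
      fun ij => TrivSqZeroExt.inl (matrixPoint (g : Matrix (Fin N) (Fin N) A) ij) +
        TrivSqZeroExt.inr (matrixPoint ((g : Matrix (Fin N) (Fin N) A) *
          X.map (algebraMap ℂ A)) ij) := by
    funext ij
    rw [matrixPoint, Matrix.SpecialLinearGroup.coe_mul, hxX, Matrix.mul_apply]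
    simp only [onePlusEps_apply, mul_add, Finset.sum_add_distrib]
    congr 1
    · have : ∀ k, ((Matrix.SpecialLinearGroup.map
        ((TrivSqZeroExt.inlAlgHom ℚ A A : A →ₐ[ℚ] A[ε]) : A →+* A[ε]) g :
        Matrix.SpecialLinearGroup (Fin N) A[ε]) : Matrix (Fin N) (Fin N) A[ε]) ij.1 k =
        TrivSqZeroExt.inl ((g : Matrix (Fin N) (Fin N) A) ij.1 k) := fun k => rfl
      simp only [this, ← TrivSqZeroExt.inl_mul]
      rw [Finset.sum_eq_single ij.2] <;> simp +contextual [matrixPoint]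
    · have : ∀ k, ((Matrix.SpecialLinearGroup.map
        ((TrivSqZeroExt.inlAlgHom ℚ A A : A →ₐ[ℚ] A[ε]) : A →+* A[ε]) g :
        Matrix.SpecialLinearGroup (Fin N) A[ε]) : Matrix (Fin N) (Fin N) A[ε]) ij.1 k =
        TrivSqZeroExt.inl ((g : Matrix (Fin N) (Fin N) A) ij.1 k) := fun k => rfl
      simp only [this, TrivSqZeroExt.inl_mul_inr, matrixPoint, Matrix.mul_apply]
      rw [← TrivSqZeroExt.inrHom_apply A, map_sum]
      rfl
  rw [e, aeval_inl_add_inr] at h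
  rw [aeval_invariantDeriv]
  simpa using congrArg TrivSqZeroExt.snd h

/-- The function `t ↦ f (exp (t X))` is entire, and its derivatives come from iterated invariant
derivatives of `f`. These all vanish at the identity, so its Taylor series at 0 is zero. -/
theorem VanishesOn.eval_exp {X : Matrix (Fin N) (Fin N) ℂ} (hX : G.IsTangent X)
    {f : MvPolynomial (Fin N × Fin N) ℂ} (hf : G.VanishesOn f) (t : ℂ) :
    MvPolynomial.eval (matrixPoint (NormedSpace.exp (t • X))) f = 0 := by
  let F : MvPolynomial (Fin N × Fin N) ℂ → ℂ → ℂ := fun f t =>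
    MvPolynomial.eval (matrixPoint (NormedSpace.exp (t • X))) f
  have hderiv : ∀ f t, HasDerivAt (F f) (F (_root_.invariantDeriv X f) t) t := by
    intro f t
    refine (hasDerivAt_eval_mvPolynomial (c := fun s => matrixPoint (NormedSpace.exp (s • X)))
      (fun ij => hasDerivAt_matrix_exp_apply X t ij.1 ij.2) f).congr_deriv ?_
    change _ = MvPolynomial.eval _ _
    rw [← MvPolynomial.coe_aeval_eq_eval]
    refine Eq.trans ?_ (aeval_invariantDeriv X f _).symm
    rw [MvPolynomial.coe_aeval_eq_eval]
    rfl
  have hiter : ∀ (n : ℕ) (f), G.VanishesOn f → iteratedDeriv n (F f) 0 = 0 := by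
    intro n
    induction n with
    | zero =>
      intro f hf
      have h := hf ℂ 1 (G.points ℂ).one_mem
      rw [Matrix.SpecialLinearGroup.coe_one] at h
      rw [iteratedDeriv_zero]
      simp only [F, zero_smul, NormedSpace.exp_zero]
      exact h
    | succ n ih =>
      intro f hf
      rw [iteratedDeriv_succ', funext fun t => (hderiv f t).deriv]
      exact ih _ (hf.invariantDeriv hX)
  have h := Complex.taylorSeries_eq_of_entire (f := F f)
    (fun t => (hderiv f t).differentiableAt) 0 t
  simp only [hiter _ f hf, smul_zero, tsum_zero] at h
  exact h.symm

theorem vanishesOn_map {f : MvPolynomial (Fin N × Fin N) ℚ} (hf : f ∈ G.eqns) :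
    G.VanishesOn (MvPolynomial.map (algebraMap ℚ ℂ) f) := by
  intro A _ _ _ g hg
  rw [MvPolynomial.aeval_map_algebraMap]
  exact hg f hf

theorem vanishesOn_det_sub_one :
    G.VanishesOn ((Matrix.mvPolynomialX (Fin N) (Fin N) ℂ).det - 1) := by
  intro A _ _ _ g _
  rw [map_sub, map_one, AlgHom.map_det, sub_eq_zero]
  convert g.2
  ext i j
  simp [matrixPoint]

/-- The exponential of an element of the complex Lie algebra lies in the complex group. -/
theorem exists_coe_eq_exp {X : Matrix (Fin N) (Fin N) ℂ} (hX : G.IsTangent X) :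
    ∃ g ∈ G.points ℂ, (g : Matrix (Fin N) (Fin N) ℂ) = NormedSpace.exp X := by
  have hdet : (NormedSpace.exp X).det = 1 := by
    have h := (vanishesOn_det_sub_one (G := G)).eval_exp hX 1
    rw [one_smul, map_sub, map_one, RingHom.map_det, sub_eq_zero] at h
    rw [← h]
    congr 1
    ext i j
    simp [matrixPoint]
  refine ⟨⟨_, hdet⟩, fun f hf => ?_, rfl⟩
  have h := (vanishesOn_map hf).eval_exp hX 1
  rw [one_smul, ← MvPolynomial.coe_aeval_eq_eval] at h
  rw [← h]
  exact (MvPolynomial.aeval_map_algebraMap ℂ _ f).symm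

end RatSubgroupSL

/-! ### Zariski closures of subgroups of `SL_N(ℂ)` -/

/-- The group `SL_N(ℂ)`. -/
abbrev ComplexSL (N : ℕ) : Type := Matrix.SpecialLinearGroup (Fin N) ℂ

section ZariskiClosure

variable {N : ℕ}

/-- The Zariski closure of a subset of `SL_N(ℂ)`. -/
def zariskiClosure (E : Set (Matrix.SpecialLinearGroup (Fin N) ℂ)) :
    Set (Matrix.SpecialLinearGroup (Fin N) ℂ) :=
  slZeroLocus {f : MvPolynomial (Fin N × Fin N) ℂ | ∀ x ∈ E,
    MvPolynomial.aeval (matrixPoint (x : Matrix (Fin N) (Fin N) ℂ)) f = 0} ℂ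

theorem subset_zariskiClosure (E : Set (ComplexSL N)) : E ⊆ zariskiClosure E :=
  fun _ hx _ hf => hf _ hx

theorem isZariskiClosed_zariskiClosure (E : Set (ComplexSL N)) :
    IsZariskiClosed (zariskiClosure E) :=
  ⟨_, rfl⟩

theorem zariskiClosure_subset {E Z : Set (ComplexSL N)} (hZ : IsZariskiClosed Z) (h : E ⊆ Z) :
    zariskiClosure E ⊆ Z := by
  obtain ⟨S, rfl⟩ := hZ
  exact fun x hx f hf => hx f fun y hy => h hy f hf

/-- A polynomial map is Zariski-continuous: equations pull back to equations by substitution. -/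
theorem zariskiClosure_mapsTo {E E' : Set (ComplexSL N)} (Φ : ComplexSL N → ComplexSL N)
    (P : Fin N × Fin N → MvPolynomial (Fin N × Fin N) ℂ)
    (hP : ∀ (x : ComplexSL N) ij, (Φ x : Matrix (Fin N) (Fin N) ℂ) ij.1 ij.2 =
      MvPolynomial.aeval (matrixPoint (x : Matrix (Fin N) (Fin N) ℂ)) (P ij))
    (h : ∀ x ∈ E, Φ x ∈ zariskiClosure E') {x : ComplexSL N} (hx : x ∈ zariskiClosure E) :
    Φ x ∈ zariskiClosure E' := by
  have key : ∀ (x : ComplexSL N) (f : MvPolynomial (Fin N × Fin N) ℂ),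
      MvPolynomial.aeval (matrixPoint (Φ x : Matrix (Fin N) (Fin N) ℂ)) f =
      MvPolynomial.aeval (matrixPoint (x : Matrix (Fin N) (Fin N) ℂ)) (MvPolynomial.bind₁ P f) := by
    intro x f
    rw [MvPolynomial.aeval_bind₁]
    congr 2
    funext ij
    exact hP x ij
  intro f hf
  refine (key x f).trans (hx _ fun y hy => ?_)
  rw [← key]
  exact h y hy f hf

theorem mul_left_mem_zariskiClosure {E E' : Set (ComplexSL N)} (h : ComplexSL N)
    (hE : ∀ x ∈ E, h * x ∈ zariskiClosure E') {x : ComplexSL N} (hx : x ∈ zariskiClosure E) :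
    h * x ∈ zariskiClosure E' :=
  zariskiClosure_mapsTo (fun x => h * x)
    (fun ij => ∑ k, MvPolynomial.C ((h : Matrix (Fin N) (Fin N) ℂ) ij.1 k) *
      MvPolynomial.X (k, ij.2))
    (fun x ij => by simp [Matrix.mul_apply, matrixPoint]) hE hx

theorem mul_right_mem_zariskiClosure {E E' : Set (ComplexSL N)} (h : ComplexSL N)
    (hE : ∀ x ∈ E, x * h ∈ zariskiClosure E') {x : ComplexSL N} (hx : x ∈ zariskiClosure E) :
    x * h ∈ zariskiClosure E' :=
  zariskiClosure_mapsTo (fun x => x * h)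
    (fun ij => ∑ k, MvPolynomial.X (ij.1, k) *
      MvPolynomial.C ((h : Matrix (Fin N) (Fin N) ℂ) k ij.2))
    (fun x ij => by simp [Matrix.mul_apply, matrixPoint]) hE hx

theorem inv_mem_zariskiClosure {E E' : Set (ComplexSL N)}
    (hE : ∀ x ∈ E, x⁻¹ ∈ zariskiClosure E') {x : ComplexSL N} (hx : x ∈ zariskiClosure E) :
    x⁻¹ ∈ zariskiClosure E' :=
  zariskiClosure_mapsTo (fun x => x⁻¹)
    -- On `SL_N` the inverse is the adjugate, which is polynomial in the entries.
    (fun ij => (Matrix.mvPolynomialX (Fin N) (Fin N) ℂ).adjugate ij.1 ij.2)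
    (fun x ij => by
      have h := AlgHom.map_adjugate (MvPolynomial.aeval (R := ℂ)
        (matrixPoint (x : Matrix (Fin N) (Fin N) ℂ))) (Matrix.mvPolynomialX (Fin N) (Fin N) ℂ)
      have h2 : (MvPolynomial.aeval (R := ℂ)
          (matrixPoint (x : Matrix (Fin N) (Fin N) ℂ))).mapMatrix
          (Matrix.mvPolynomialX (Fin N) (Fin N) ℂ) = (x : Matrix (Fin N) (Fin N) ℂ) := by
        ext i j
        simp [matrixPoint]
      rw [h2] at h
      rw [Matrix.SpecialLinearGroup.coe_inv, ← h]
      rfl) hE hx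

/-- The Zariski closure of a subgroup of `SL_N(ℂ)`, as a subgroup. -/
def zariskiClosureSubgroup (E : Subgroup (Matrix.SpecialLinearGroup (Fin N) ℂ)) :
    Subgroup (Matrix.SpecialLinearGroup (Fin N) ℂ) where
  carrier := zariskiClosure E
  one_mem' := subset_zariskiClosure _ E.one_mem
  mul_mem' := fun {x y} hx hy => by
    -- Multiplication is treated one factor at a time: first `z * y` for `z ∈ E` and `y` in the
    -- closure, then the left factor is moved to the closure.
    refine mul_right_mem_zariskiClosure (E := (E : Set (ComplexSL N))) y (fun z hz => ?_) hx
    exact mul_left_mem_zariskiClosure (E := (E : Set (ComplexSL N))) z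
      (fun w hw => subset_zariskiClosure _ (E.mul_mem hz hw)) hy
  inv_mem' := fun {x} hx => inv_mem_zariskiClosure (E := (E : Set (ComplexSL N)))
    (fun z hz => subset_zariskiClosure _ (E.inv_mem hz)) hx

theorem conj_mem_zariskiClosure {E : Set (ComplexSL N)} (g : ComplexSL N)
    (hE : ∀ x ∈ E, g * x * g⁻¹ ∈ E) {x : ComplexSL N} (hx : x ∈ zariskiClosure E) : g * x * g⁻¹ ∈ zariskiClosure E := by
  have h : g * x ∈ zariskiClosure ((fun y => g * y) '' E) :=
    mul_left_mem_zariskiClosure g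
      (fun y hy => subset_zariskiClosure _ (Set.mem_image_of_mem _ hy)) hx
  refine mul_right_mem_zariskiClosure g⁻¹ ?_ h
  rintro _ ⟨y, hy, rfl⟩
  exact subset_zariskiClosure _ (hE y hy)

theorem isZariskiClosed_centralizer (h : ComplexSL N) :
    IsZariskiClosed {x : ComplexSL N | h * x = x * h} := by
  refine ⟨Set.range fun ij : Fin N × Fin N =>
    ∑ k, MvPolynomial.C ((h : Matrix (Fin N) (Fin N) ℂ) ij.1 k) * MvPolynomial.X (k, ij.2) -
    ∑ k, MvPolynomial.X (ij.1, k) * MvPolynomial.C ((h : Matrix (Fin N) (Fin N) ℂ) k ij.2), ?_⟩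
  ext x
  have e : ∀ ij : Fin N × Fin N, MvPolynomial.aeval
      (fun ij : Fin N × Fin N => (x : Matrix (Fin N) (Fin N) ℂ) ij.1 ij.2)
      (∑ k, MvPolynomial.C ((h : Matrix (Fin N) (Fin N) ℂ) ij.1 k) * MvPolynomial.X (k, ij.2) -
        ∑ k, MvPolynomial.X (ij.1, k) * MvPolynomial.C ((h : Matrix (Fin N) (Fin N) ℂ) k ij.2)) =
      ((h * x : ComplexSL N) : Matrix (Fin N) (Fin N) ℂ) ij.1 ij.2 -
        ((x * h : ComplexSL N) : Matrix (Fin N) (Fin N) ℂ) ij.1 ij.2 := by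
    intro ij
    simp [Matrix.mul_apply]
  constructor
  · rintro hx _ ⟨ij, rfl⟩
    rw [e, show h * x = x * h from hx, sub_self]
  · intro hx
    apply Subtype.ext
    ext i j
    have := hx _ ⟨(i, j), rfl⟩
    rw [e] at this
    exact sub_eq_zero.1 this

/-- Centralizers are closed. Using this once shows that the closure commutes with `E`, and using it
again that the closure commutes with itself. -/
theorem zariskiClosure_comm {E : Set (ComplexSL N)}
    (hE : ∀ x ∈ E, ∀ y ∈ E, x * y = y * x) {x y : ComplexSL N} (hx : x ∈ zariskiClosure E) (hy : y ∈ zariskiClosure E) : x * y = y * x := by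
  have h1 : ∀ z ∈ E, z * y = y * z := fun z hz =>
    zariskiClosure_subset (isZariskiClosed_centralizer z) (fun w hw => hE z hz w hw) hy
  exact (zariskiClosure_subset (isZariskiClosed_centralizer y)
    (fun w hw => (h1 w hw).symm) hx).symm

end ZariskiClosure

theorem continuous_exp_smul {N : ℕ} (X : Matrix (Fin N) (Fin N) ℂ) (i j : Fin N) :
    Continuous fun s : ℂ => NormedSpace.exp (s • X) i j :=
  continuous_iff_continuousAt.2 fun t => (hasDerivAt_matrix_exp_apply X t i j).continuousAt

theorem isClosed_preimage_of_isZariskiClosed {N : ℕ} {T : Type*} [TopologicalSpace T]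
    {Z : Set (Matrix.SpecialLinearGroup (Fin N) ℂ)} (hZ : IsZariskiClosed Z)
    (c : T → Matrix.SpecialLinearGroup (Fin N) ℂ)
    (hc : ∀ i j, Continuous fun t => (c t : Matrix (Fin N) (Fin N) ℂ) i j) :
    IsClosed (c ⁻¹' Z) := by
  obtain ⟨S, rfl⟩ := hZ
  have : c ⁻¹' slZeroLocus S ℂ = ⋂ f ∈ S, {t | MvPolynomial.eval
      (fun ij : Fin N × Fin N => (c t : Matrix (Fin N) (Fin N) ℂ) ij.1 ij.2) f = 0} := by
    ext t
    simp only [Set.mem_preimage, Set.mem_iInter, Set.mem_ofPred_eq]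
    rfl
  rw [this]
  refine isClosed_biInter fun f _ => isClosed_eq ?_ continuous_const
  exact (MvPolynomial.continuous_eval f).comp (continuous_pi fun ij => hc ij.1 ij.2)

/-- Zariski-closed sets have Euclidean-closed preimages in the parameter plane, and `ℂ` is
connected. A curve in `E` from `1` to `x` therefore cannot be split between two disjoint closed
pieces of the closure. -/
theorem isZariskiConnected_zariskiClosure {N : ℕ}
    {E : Set (Matrix.SpecialLinearGroup (Fin N) ℂ)} (h1 : 1 ∈ E)
    (hE : ∀ x ∈ E, ∃ c : ℂ → Matrix.SpecialLinearGroup (Fin N) ℂ,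
      (∀ i j, Continuous fun t => (c t : Matrix (Fin N) (Fin N) ℂ) i j) ∧
      (∀ t, c t ∈ E) ∧ c 0 = 1 ∧ c 1 = x) : IsZariskiConnected (zariskiClosure E) := by
  refine ⟨⟨1, subset_zariskiClosure _ h1⟩, ?_⟩
  have key : ∀ Z₁ Z₂ : Set (Matrix.SpecialLinearGroup (Fin N) ℂ), IsZariskiClosed Z₁ →
      IsZariskiClosed Z₂ → zariskiClosure E ⊆ Z₁ ∪ Z₂ → zariskiClosure E ∩ (Z₁ ∩ Z₂) = ∅ →
      1 ∈ Z₁ → zariskiClosure E ⊆ Z₁ := by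
    intro Z₁ Z₂ hZ₁ hZ₂ hcov hdisj h1
    refine zariskiClosure_subset hZ₁ fun x hx => ?_
    obtain ⟨c, hc, hcE, hc0, hc1⟩ := hE x hx
    have hmem : ∀ t, c t ∈ zariskiClosure E := fun t => subset_zariskiClosure _ (hcE t)
    by_contra hx1
    obtain ⟨t, -, ht⟩ := isPreconnected_closed_iff.1
      (isPreconnected_univ (α := ℂ)) (c ⁻¹' Z₁) (c ⁻¹' Z₂)
      (isClosed_preimage_of_isZariskiClosed hZ₁ c hc)
      (isClosed_preimage_of_isZariskiClosed hZ₂ c hc) (fun t _ => hcov (hmem t))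
      ⟨0, trivial, by rw [Set.mem_preimage, hc0]; exact h1⟩
      ⟨1, trivial, by
        rw [Set.mem_preimage, hc1]
        exact (hcov (subset_zariskiClosure _ hx)).resolve_left hx1⟩
    have : c t ∈ zariskiClosure E ∩ (Z₁ ∩ Z₂) := ⟨hmem t, ht⟩
    rw [hdisj] at this
    exact this
  intro Z₁ Z₂ hZ₁ hZ₂ hcov hdisj
  rcases hcov (subset_zariskiClosure _ h1) with h | h
  · exact Or.inl (key Z₁ Z₂ hZ₁ hZ₂ hcov hdisj h)
  · exact Or.inr (key Z₂ Z₁ hZ₂ hZ₁ (by rwa [Set.union_comm]) (by rwa [Set.inter_comm Z₂]) h)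

/-! ### Semisimple groups have semisimple Lie algebras -/

section LastDerived

variable {k L : Type*} [Field k] [LieRing L] [LieAlgebra k L]

theorem LieEquiv.mem_derivedSeriesOfIdeal (e : L ≃ₗ⁅k⁆ L) (I : LieIdeal k L)
    (hI : ∀ x ∈ I, e x ∈ I) (n : ℕ) :
    ∀ x ∈ LieAlgebra.derivedSeriesOfIdeal k L n I,
      e x ∈ LieAlgebra.derivedSeriesOfIdeal k L n I := by
  induction n with
  | zero => exact hI
  | succ n ih =>
    intro x hx
    rw [LieAlgebra.derivedSeriesOfIdeal_succ] at hx ⊢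
    rw [← LieSubmodule.mem_toSubmodule, LieSubmodule.lieIdeal_oper_eq_linear_span'] at hx ⊢
    have h := Submodule.mem_map_of_mem (f := (e : L →ₗ[k] L)) hx
    rw [Submodule.map_span] at h
    refine Submodule.span_mono ?_ h
    rintro _ ⟨_, ⟨y, hy, z, hz, rfl⟩, rfl⟩
    exact ⟨e y, ih y hy, e z, ih z hz, (e.map_lie y z).symm⟩

theorem LieEquiv.mem_radical [IsNoetherian k L] (e : L ≃ₗ⁅k⁆ L) {x : L}
    (hx : x ∈ LieAlgebra.radical k L) : e x ∈ LieAlgebra.radical k L := by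
  let J : LieIdeal k L := (LieAlgebra.radical k L).comap (e.symm : L →ₗ⁅k⁆ L)
  have hJ : LieAlgebra.IsSolvable J := by
    let f : J →ₗ⁅k⁆ LieAlgebra.radical k L :=
      { toFun := fun y => ⟨e.symm y.1, by have := y.2; rwa [LieIdeal.mem_comap] at this⟩
        map_add' := fun y z => Subtype.ext (map_add e.symm y.1 z.1)
        map_smul' := fun c y => Subtype.ext (map_smul e.symm c y.1)
        map_lie' := fun {y z} => Subtype.ext (e.symm.map_lie y.1 z.1) }
    refine Function.Injective.lieAlgebra_isSolvable (f := f) fun y z h => Subtype.ext ?_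
    exact e.symm.injective (congrArg Subtype.val h)
  refine (LieAlgebra.LieIdeal.solvable_iff_le_radical k L J).1 hJ ?_
  rw [LieIdeal.mem_comap]
  simpa using hx

/-- If every abelian ideal stable under automorphisms of a certain class vanishes, the radical is
trivial. -/
theorem hasTrivialRadical_of_forall_abelian [IsNoetherian k L] (S : Set (L ≃ₗ⁅k⁆ L))
    (h : ∀ I : LieIdeal k L, IsLieAbelian I → (∀ e ∈ S, ∀ x ∈ I, e x ∈ I) → I = ⊥) :
    LieAlgebra.HasTrivialRadical k L := by
  constructor
  rw [← LieAlgebra.abelian_of_solvable_ideal_eq_bot_iff]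
  refine h _ (LieAlgebra.abelian_derivedAbelianOfIdeal _) fun e _ x hx => ?_
  unfold LieAlgebra.derivedAbelianOfIdeal at hx ⊢
  -- The ideal in question is the last nonzero term of the derived series of the radical, or zero.
  -- Automorphisms preserve the radical and hence this term.
  split at hx
  · simp_all
  · exact e.mem_derivedSeriesOfIdeal _ (fun y hy => e.mem_radical hy) _ x hx

end LastDerived

/-! ### Abelian ideals stable under the adjoint action -/

namespace RatSubgroupSL

variable {N : ℕ} (G : RatSubgroupSL N)

/-- The adjoint action of `G(A)` on `Lie(G)(A)` by Lie algebra automorphisms. -/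
noncomputable def adEquiv {A : Type} [CommRing A] [Algebra ℚ A] (g : G.points A) :
    G.lieAlgebra A ≃ₗ⁅A⁆ G.lieAlgebra A where
  toFun X := ⟨(g.1 : Matrix (Fin N) (Fin N) A) * (X : Matrix (Fin N) (Fin N) A) *
    ((g.1⁻¹ : Matrix.SpecialLinearGroup (Fin N) A) : Matrix (Fin N) (Fin N) A),
    IsTangent.conj G X.2 g.2⟩
  invFun X := ⟨((g.1⁻¹ : Matrix.SpecialLinearGroup (Fin N) A) : Matrix (Fin N) (Fin N) A) *
    (X : Matrix (Fin N) (Fin N) A) * (g.1 : Matrix (Fin N) (Fin N) A), by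
    have := IsTangent.conj G X.2 ((G.points A).inv_mem g.2)
    rwa [inv_inv] at this⟩
  map_add' X Y := Subtype.ext (by simp [mul_add, add_mul])
  map_smul' c X := Subtype.ext (by simp)
  map_lie' := fun {X Y} => Subtype.ext (by
    have h : ((g.1⁻¹ : Matrix.SpecialLinearGroup (Fin N) A) : Matrix (Fin N) (Fin N) A) *
        (g.1 : Matrix (Fin N) (Fin N) A) = 1 := by
      rw [← Matrix.SpecialLinearGroup.coe_mul, inv_mul_cancel, Matrix.SpecialLinearGroup.coe_one]
    simp only [LieSubalgebra.coe_bracket, Ring.lie_def, mul_sub, sub_mul]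
    have e : ∀ P Q : Matrix (Fin N) (Fin N) A,
        (g.1 : Matrix (Fin N) (Fin N) A) * P *
        ((g.1⁻¹ : Matrix.SpecialLinearGroup (Fin N) A) : Matrix (Fin N) (Fin N) A) *
        ((g.1 : Matrix (Fin N) (Fin N) A) * Q *
        ((g.1⁻¹ : Matrix.SpecialLinearGroup (Fin N) A) : Matrix (Fin N) (Fin N) A)) =
        (g.1 : Matrix (Fin N) (Fin N) A) * (P * Q) *
        ((g.1⁻¹ : Matrix.SpecialLinearGroup (Fin N) A) : Matrix (Fin N) (Fin N) A) := by
      intro P Q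
      calc _ = (g.1 : Matrix (Fin N) (Fin N) A) * P *
        (((g.1⁻¹ : Matrix.SpecialLinearGroup (Fin N) A) : Matrix (Fin N) (Fin N) A) *
        (g.1 : Matrix (Fin N) (Fin N) A)) * Q *
        ((g.1⁻¹ : Matrix.SpecialLinearGroup (Fin N) A) : Matrix (Fin N) (Fin N) A) := by
            simp only [mul_assoc]
        _ = _ := by rw [h, mul_one]; simp only [mul_assoc]
    rw [e, e])
  left_inv X := Subtype.ext (by
    have h : ((g.1⁻¹ : Matrix.SpecialLinearGroup (Fin N) A) : Matrix (Fin N) (Fin N) A) *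
        (g.1 : Matrix (Fin N) (Fin N) A) = 1 := by
      rw [← Matrix.SpecialLinearGroup.coe_mul, inv_mul_cancel, Matrix.SpecialLinearGroup.coe_one]
    change _ * (_ * _ * _) * _ = _
    simp only [← mul_assoc]
    rw [h, one_mul, mul_assoc, h, mul_one])
  right_inv X := Subtype.ext (by
    have h : (g.1 : Matrix (Fin N) (Fin N) A) *
        ((g.1⁻¹ : Matrix.SpecialLinearGroup (Fin N) A) : Matrix (Fin N) (Fin N) A) = 1 := by
      rw [← Matrix.SpecialLinearGroup.coe_mul, mul_inv_cancel, Matrix.SpecialLinearGroup.coe_one]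
    change _ * (_ * _ * _) * _ = _
    simp only [← mul_assoc]
    rw [h, one_mul, mul_assoc, h, mul_one])

variable {G}

/-- As `I` is abelian, `exp I` is a commutative subgroup; it is normal in `G(ℂ)` because `I` is
`Ad`-stable, and joined to `1` by the curves `exp (t x)`. All of this passes to its Zariski closure,
which semisimplicity forces to be trivial. -/
theorem eq_bot_of_isLieAbelian (hG : G.IsSemisimple) (I : LieIdeal ℂ (G.lieAlgebra ℂ))
    (hI : IsLieAbelian I) (hAd : ∀ g : G.points ℂ, ∀ x ∈ I, G.adEquiv g x ∈ I) : I = ⊥ := by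
  have hcomm : ∀ x ∈ I, ∀ y ∈ I, Commute (x : Matrix (Fin N) (Fin N) ℂ) (y : Matrix _ _ ℂ) := by
    intro x hx y hy
    have h : (⁅(⟨x, hx⟩ : I), (⟨y, hy⟩ : I)⁆ : I) = 0 := hI.trivial _ _
    have h2 : ⁅x, y⁆ = 0 := congrArg Subtype.val h
    have h3 := congrArg (Subtype.val : G.lieAlgebra ℂ → Matrix (Fin N) (Fin N) ℂ) h2
    rw [LieSubalgebra.coe_bracket, Ring.lie_def] at h3
    exact sub_eq_zero.1 h3
  let E : Subgroup (Matrix.SpecialLinearGroup (Fin N) ℂ) :=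
    { carrier := {h | ∃ x ∈ I, (h : Matrix (Fin N) (Fin N) ℂ) =
        NormedSpace.exp (x : Matrix (Fin N) (Fin N) ℂ)}
      one_mem' := ⟨0, I.zero_mem, by simp⟩
      mul_mem' := by
        rintro g h ⟨x, hx, hg⟩ ⟨y, hy, hh⟩
        refine ⟨x + y, I.add_mem hx hy, ?_⟩
        rw [Matrix.SpecialLinearGroup.coe_mul, hg, hh]
        exact (Matrix.exp_add_of_commute _ _ (hcomm x hx y hy)).symm
      inv_mem' := by
        rintro g ⟨x, hx, hg⟩
        refine ⟨-x, I.neg_mem hx, ?_⟩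
        refine left_inv_eq_right_inv (a := (g : Matrix (Fin N) (Fin N) ℂ))
          (b := ((g⁻¹ : Matrix.SpecialLinearGroup (Fin N) ℂ) : Matrix (Fin N) (Fin N) ℂ)) ?_ ?_
        · rw [← Matrix.SpecialLinearGroup.coe_mul, inv_mul_cancel,
            Matrix.SpecialLinearGroup.coe_one]
        · rw [hg, ← Matrix.exp_add_of_commute]
          · simp
          · exact hcomm x hx _ (I.neg_mem hx) }
  have hexp : ∀ x ∈ I, ∃ h ∈ E, (h : Matrix (Fin N) (Fin N) ℂ) =
      NormedSpace.exp (x : Matrix (Fin N) (Fin N) ℂ) := by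
    intro x hx
    obtain ⟨g, hg, hgx⟩ := exists_coe_eq_exp x.2
    exact ⟨g, ⟨x, hx, hgx⟩, hgx⟩
  have hEG : E ≤ G.points ℂ := by
    rintro h ⟨x, hx, hh⟩
    obtain ⟨g, hg, hgx⟩ := exists_coe_eq_exp x.2
    rwa [show h = g from Subtype.ext (hh.trans hgx.symm)]
  have hclosed : IsZariskiClosed (G.points ℂ : Set (Matrix.SpecialLinearGroup (Fin N) ℂ)) := by
    refine ⟨MvPolynomial.map (algebraMap ℚ ℂ) '' G.eqns, ?_⟩
    ext g
    simp only [slZeroLocus, Set.mem_ofPred_eq, Set.forall_mem_image,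
      MvPolynomial.aeval_map_algebraMap]
    rfl
  have hbot := hG (zariskiClosureSubgroup E) (zariskiClosure_subset hclosed hEG) ⟨?_⟩
    (isZariskiClosed_zariskiClosure _) (isZariskiConnected_zariskiClosure E.one_mem ?_) ?_
  · rw [eq_bot_iff]
    intro x hx
    have h1 : ∀ t : ℂ, NormedSpace.exp (t • (x : Matrix (Fin N) (Fin N) ℂ)) = 1 := by
      intro t
      obtain ⟨h, hh, hhx⟩ := hexp (t • x) (I.smul_mem t hx)
      have : h ∈ zariskiClosureSubgroup E := subset_zariskiClosure _ hh
      rw [hbot, Subgroup.mem_bot] at this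
      rw [this] at hhx
      exact hhx.symm
    rw [LieSubmodule.mem_bot]
    apply Subtype.ext
    ext i j
    -- The curve `exp (t x)` is constantly `1`, and its derivative at `0` is `x`.
    have h2 := hasDerivAt_matrix_exp_apply (x : Matrix (Fin N) (Fin N) ℂ) 0 i j
    simp only [h1, one_mul] at h2
    exact h2.unique (hasDerivAt_const _ _)
  · intro h hh g
    rw [Subgroup.mem_subgroupOf] at hh ⊢
    refine conj_mem_zariskiClosure (g : Matrix.SpecialLinearGroup (Fin N) ℂ) ?_ hh
    rintro y ⟨x, hx, hyx⟩
    refine ⟨G.adEquiv g x, hAd g x hx, ?_⟩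
    have hinv : ((g.1⁻¹ : Matrix.SpecialLinearGroup (Fin N) ℂ) : Matrix (Fin N) (Fin N) ℂ) =
        (g.1 : Matrix (Fin N) (Fin N) ℂ)⁻¹ := by
      refine (Matrix.inv_eq_right_inv ?_).symm
      rw [← Matrix.SpecialLinearGroup.coe_mul, mul_inv_cancel, Matrix.SpecialLinearGroup.coe_one]
    change _ = NormedSpace.exp ((g.1 : Matrix (Fin N) (Fin N) ℂ) *
      (x : Matrix (Fin N) (Fin N) ℂ) *
      ((g.1⁻¹ : Matrix.SpecialLinearGroup (Fin N) ℂ) : Matrix (Fin N) (Fin N) ℂ))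
    rw [hinv, Matrix.exp_conj _ _ ((Matrix.isUnit_iff_isUnit_det _).2 (by rw [g.1.2]; simp)),
      Matrix.SpecialLinearGroup.coe_mul, Matrix.SpecialLinearGroup.coe_mul, hyx, hinv]
  · rintro y ⟨x, hx, hyx⟩
    choose c hcE hc using fun t : ℂ => hexp (t • x) (I.smul_mem t hx)
    refine ⟨c, fun i j => ?_, hcE, ?_, ?_⟩
    · simp only [hc]
      exact continuous_exp_smul _ i j
    · apply Subtype.ext
      rw [hc]
      simp
    · apply Subtype.ext
      rw [hc, hyx]
      simp
  · refine Group.isSolvable_of_comm fun a b => Subtype.ext ?_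
    refine zariskiClosure_comm ?_ a.2 b.2
    rintro y ⟨x, hx, hyx⟩ z ⟨w, hw, hzw⟩
    apply Subtype.ext
    rw [Matrix.SpecialLinearGroup.coe_mul, Matrix.SpecialLinearGroup.coe_mul, hyx, hzw,
      ← Matrix.exp_add_of_commute _ _ (hcomm x hx w hw),
      ← Matrix.exp_add_of_commute _ _ (hcomm w hw x hx), add_comm]

theorem hasTrivialRadical_complex (hG : G.IsSemisimple) :
    LieAlgebra.HasTrivialRadical ℂ (G.lieAlgebra ℂ) :=
  hasTrivialRadical_of_forall_abelian (Set.range G.adEquiv) fun I hI h =>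
    eq_bot_of_isLieAbelian hG I hI fun g => h _ ⟨g, rfl⟩

end RatSubgroupSL

/-! ### Definite seminorms on finite-dimensional real vector spaces -/

section DefiniteSeminorm

variable {V W U : Type*} [AddCommGroup V] [Module ℝ V] [AddCommGroup W] [Module ℝ W]
  [AddCommGroup U] [Module ℝ U]

/-- The normed group structure given by a definite seminorm. -/
@[reducible]
noncomputable def Seminorm.normedAddCommGroupOfDefinite (p : Seminorm ℝ V)
    (hp : ∀ x, p x = 0 → x = 0) : NormedAddCommGroup V :=
  AddGroupNorm.toNormedAddCommGroup
    { toFun := p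
      map_zero' := map_zero p
      add_le' := map_add_le_add p
      neg' := map_neg_eq_map p
      eq_zero_of_map_eq_zero' := hp }

/-- The normed space structure given by a definite seminorm. -/
@[reducible]
noncomputable def Seminorm.normedSpaceOfDefinite (p : Seminorm ℝ V)
    (hp : ∀ x, p x = 0 → x = 0) :
    letI := p.normedAddCommGroupOfDefinite hp
    NormedSpace ℝ V :=
  letI := p.normedAddCommGroupOfDefinite hp
  { norm_smul_le := fun c x => (map_smul_eq_mul p c x).le }

/-- The symmetric bilinear form associated with `q` is an inner product, so the triangle inequality
comes from Cauchy–Schwarz. -/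
theorem exists_seminorm_eq_sqrt (q : QuadraticForm ℝ V) (hq : q.PosDef) :
    ∃ p : Seminorm ℝ V, (∀ x, p x = Real.sqrt (q x)) ∧ ∀ x, p x = 0 → x = 0 := by
  let B := QuadraticMap.associated (R := ℝ) q
  have hB : ∀ x, B x x = q x := fun x => QuadraticMap.associated_eq_self_apply ℝ q x
  let c : InnerProductSpace.Core ℝ V :=
    { inner := fun x y => B x y
      conj_inner_symm := fun x y => by
        simp only [conj_trivial]
        exact QuadraticMap.associated_isSymm ℝ q y x
      re_inner_nonneg := fun x => by
        change 0 ≤ B x x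
        rw [hB]
        exact hq.nonneg x
      add_left := fun x y z => by simp
      smul_left := fun x y r => by simp
      definite := fun x hx => hq.anisotropic x (by rw [← hB]; exact hx) }
  let := c.toNormedAddCommGroup
  let := InnerProductSpace.ofCore c.toCore
  have hn : ∀ x : V, ‖x‖ = Real.sqrt (q x) := by
    intro x
    rw [← hB]
    rfl
  refine ⟨normSeminorm ℝ V, fun x => hn x, fun x hx => norm_eq_zero.1 hx⟩

variable [FiniteDimensional ℝ V]

theorem exists_forall_abs_le_mul (p : Seminorm ℝ V) (hp : ∀ x, p x = 0 → x = 0)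
    (φ : V →ₗ[ℝ] ℝ) : ∃ c, 0 < c ∧ ∀ x, |φ x| ≤ c * p x := by
  let := p.normedAddCommGroupOfDefinite hp
  let := p.normedSpaceOfDefinite hp
  let ψ : V →L[ℝ] ℝ := LinearMap.toContinuousLinearMap φ
  refine ⟨‖ψ‖ + 1, by positivity, fun x => ?_⟩
  have h := ψ.le_opNorm x
  have h0 : 0 ≤ ‖x‖ := norm_nonneg x
  calc |φ x| ≤ ‖ψ‖ * ‖x‖ := h
    _ ≤ (‖ψ‖ + 1) * ‖x‖ := by gcongr; linarith

theorem exists_forall_map_le_mul (p : Seminorm ℝ V) (hp : ∀ x, p x = 0 → x = 0)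
    (p' : Seminorm ℝ W) (φ : V →ₗ[ℝ] W) : ∃ c, 0 < c ∧ ∀ x, p' (φ x) ≤ c * p x := by
  let b := Module.finBasis ℝ V
  choose c hc0 hc using fun i => exists_forall_abs_le_mul p hp (b.coord i)
  refine ⟨∑ i, c i * p' (φ (b i)) + 1, ?_, fun x => ?_⟩
  · have : 0 ≤ ∑ i, c i * p' (φ (b i)) :=
      Finset.sum_nonneg fun i _ => mul_nonneg (hc0 i).le (apply_nonneg _ _)
    linarith
  · have h : φ x = ∑ i, b.coord i x • φ (b i) := by
      conv_lhs => rw [← b.sum_repr x, map_sum]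
      simp only [map_smul]
      rfl
    calc p' (φ x) ≤ ∑ i, p' (b.coord i x • φ (b i)) := by
          rw [h]; exact Finset.le_sum_of_subadditive p' (map_zero p').le (map_add_le_add p') _ _
      _ ≤ ∑ i, c i * p' (φ (b i)) * p x := by
          refine Finset.sum_le_sum fun i _ => ?_
          rw [map_smul_eq_mul, Real.norm_eq_abs]
          have := mul_le_mul_of_nonneg_right (hc i x) (apply_nonneg p' (φ (b i)))
          linarith
      _ ≤ _ := by
          rw [← Finset.sum_mul, add_mul]
          have := apply_nonneg p x
          linarith

variable [FiniteDimensional ℝ W] in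
theorem exists_forall_map₂_le_mul (p : Seminorm ℝ V) (hp : ∀ x, p x = 0 → x = 0)
    (p' : Seminorm ℝ W) (hp' : ∀ x, p' x = 0 → x = 0) (p'' : Seminorm ℝ U)
    (β : V →ₗ[ℝ] W →ₗ[ℝ] U) : ∃ c, 0 < c ∧ ∀ x y, p'' (β x y) ≤ c * (p x * p' y) := by
  let b := Module.finBasis ℝ V
  choose c hc0 hc using fun i => exists_forall_abs_le_mul p hp (b.coord i)
  choose d hd0 hd using fun i => exists_forall_map_le_mul p' hp' p'' (β (b i))
  refine ⟨∑ i, c i * d i + 1, ?_, fun x y => ?_⟩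
  · have : 0 ≤ ∑ i, c i * d i :=
      Finset.sum_nonneg fun i _ => mul_nonneg (hc0 i).le (hd0 i).le
    linarith
  · have h : β x y = ∑ i, b.coord i x • β (b i) y := by
      conv_lhs => rw [← b.sum_repr x, map_sum]
      simp only [map_smul, LinearMap.smul_apply, LinearMap.sum_apply]
      rfl
    have hxy : 0 ≤ p x * p' y := mul_nonneg (apply_nonneg _ _) (apply_nonneg _ _)
    calc p'' (β x y) ≤ ∑ i, p'' (b.coord i x • β (b i) y) := by
          rw [h]; exact Finset.le_sum_of_subadditive p'' (map_zero p'').le (map_add_le_add p'') _ _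
      _ ≤ ∑ i, c i * d i * (p x * p' y) := by
          refine Finset.sum_le_sum fun i _ => ?_
          rw [map_smul_eq_mul, Real.norm_eq_abs]
          have := mul_le_mul (hc i x) (hd i y) (apply_nonneg _ _)
            (mul_nonneg (hc0 i).le (apply_nonneg _ _))
          linarith
      _ ≤ _ := by
          rw [← Finset.sum_mul, add_mul]
          linarith

/-- A subgroup that meets every ball in a finite set and spans the space is generated by a
basis of the space. -/
theorem exists_basis_closure_eq (p : Seminorm ℝ V) (hp : ∀ x, p x = 0 → x = 0)
    (Λ : AddSubgroup V) (hfin : ∀ ρ : ℝ, {x | x ∈ Λ ∧ p x ≤ ρ}.Finite)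
    (hspan : Submodule.span ℝ (Λ : Set V) = ⊤) :
    ∃ b : Module.Basis (Fin (Module.finrank ℝ V)) ℝ V,
      Submodule.span ℤ (Set.range b) = AddSubgroup.toIntSubmodule Λ := by
  let := p.normedAddCommGroupOfDefinite hp
  let := p.normedSpaceOfDefinite hp
  let M : Submodule ℤ V := AddSubgroup.toIntSubmodule Λ
  have hdisc : DiscreteTopology M := by
    rw [discreteTopology_iff_isOpen_singleton_zero]
    -- Removing the finitely many nonzero lattice points from the unit ball leaves a neighbourhood
    -- of zero that isolates it.
    have hF : {x : V | x ∈ Λ ∧ ‖x‖ ≤ 1 ∧ x ≠ 0}.Finite :=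
      (hfin 1).subset fun x hx => ⟨hx.1, hx.2.1⟩
    refine ⟨Metric.ball 0 1 ∩ {x : V | x ∈ Λ ∧ ‖x‖ ≤ 1 ∧ x ≠ 0}ᶜ,
      Metric.isOpen_ball.inter hF.isClosed.isOpen_compl, ?_⟩
    ext x
    simp only [Set.mem_preimage, Set.mem_inter_iff, mem_ball_zero_iff, Set.mem_compl_iff,
      Set.mem_ofPred_eq, Set.mem_singleton_iff]
    constructor
    · rintro ⟨h1, h2⟩
      by_contra hx
      exact h2 ⟨x.2, h1.le, fun h => hx (Subtype.ext h)⟩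
    · rintro rfl
      simp
  have : IsZLattice ℝ M := ⟨hspan⟩
  have := ZLattice.module_finite ℝ M
  have := ZLattice.module_free ℝ M
  let b := Module.finBasisOfFinrankEq ℤ M (ZLattice.rank ℝ M)
  exact ⟨b.ofZLatticeBasis ℝ M, b.ofZLatticeBasis_span ℝ M⟩

end DefiniteSeminorm

/-! ### Geometry of numbers -/

section GeometryOfNumbers

/-- A discrete subgroup is generated by vectors of bounded length as soon as every functional that
is integral and nonzero on it has norm bounded below. -/
theorem le_closure_short_of_dual_bound {E : Type*} [NormedAddCommGroup E] [NormedSpace ℝ E]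
    [FiniteDimensional ℝ E] (n : ℕ) (hn : Module.finrank ℝ E = n) (D : AddSubgroup E)
    (hfin : ∀ ρ : ℝ, {x | x ∈ D ∧ ‖x‖ ≤ ρ}.Finite) (R : ℝ) (hR : 0 < R)
    (hdual : ∀ φ : E →L[ℝ] ℝ, (∀ x ∈ D, ∃ m : ℤ, φ x = m) → (∃ x ∈ D, φ x ≠ 0) → 1 ≤ R * ‖φ‖) :
    D ≤ AddSubgroup.closure {x | x ∈ D ∧ ‖x‖ ≤ 4 ^ n * R} := by
  induction n generalizing E with
  | zero =>
    intro x _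
    have := Module.finrank_zero_iff.1 hn
    rw [Subsingleton.elim x 0]
    exact zero_mem _
  | succ m ih =>
    by_cases hD : ∀ x ∈ D, x = 0
    · intro x hx
      rw [hD x hx]
      exact zero_mem _
    push Not at hD
    obtain ⟨x₀, hx₀, hx₀0⟩ := hD
    -- The vector `u` is a shortest nonzero one in `D`; the induction passes to the quotient by the
    -- line it spans.
    obtain ⟨u, ⟨⟨huD, -⟩, hu0⟩, humin'⟩ := Set.exists_min_image
      ({x | x ∈ D ∧ ‖x‖ ≤ ‖x₀‖} ∩ {x | x ≠ 0}) norm ((hfin _).inter_of_left _)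
      ⟨x₀, ⟨hx₀, le_rfl⟩, hx₀0⟩
    have humin : ∀ x ∈ D, x ≠ 0 → ‖u‖ ≤ ‖x‖ := by
      intro x hx hx0
      by_cases h : ‖x‖ ≤ ‖x₀‖
      · exact humin' x ⟨⟨hx, h⟩, hx0⟩
      · exact (humin' x₀ ⟨⟨hx₀, le_rfl⟩, hx₀0⟩).trans (not_le.1 h).le
    have hu0' : 0 < ‖u‖ := norm_pos_iff.2 hu0
    let S : Submodule ℝ E := Submodule.span ℝ {u}
    have hSc : IsClosed (S : Set E) := S.closed_of_finiteDimensional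
    let π : E →L[ℝ] E ⧸ S := S.mkQL
    have hπ0 : ∀ x, π x = 0 ↔ ∃ t : ℝ, t • u = x := fun x =>
      (Submodule.Quotient.mk_eq_zero S).trans Submodule.mem_span_singleton
    have hround : ∀ t : ℝ, ‖(t - round t) • u‖ ≤ ‖u‖ / 2 := by
      intro t
      rw [norm_smul, Real.norm_eq_abs]
      have := mul_le_mul_of_nonneg_right (abs_sub_round t) hu0'.le
      linarith
    have hzD : ∀ t : ℝ, (round t : ℝ) • u ∈ D := by
      intro t
      rw [Int.cast_smul_eq_zsmul]
      exact D.zsmul_mem huD _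
    -- Subtracting the nearest integer multiple of `u` leaves an element of `D` of norm at most `‖u‖
    -- / 2`, which is zero by minimality.
    have hmult : ∀ x ∈ D, π x = 0 → ∃ k : ℤ, x = k • u := by
      intro x hx hπx
      obtain ⟨t, rfl⟩ := (hπ0 x).1 hπx
      refine ⟨round t, ?_⟩
      by_contra hne
      have h1 : (t - round t) • u ∈ D := by
        rw [sub_smul]
        exact D.sub_mem hx (hzD t)
      have h2 : (t - round t) • u ≠ 0 := by
        rw [sub_smul, sub_ne_zero, Int.cast_smul_eq_zsmul]
        exact hne
      have := humin _ h1 h2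
      have := hround t
      linarith
    let D' : AddSubgroup (E ⧸ S) := D.map (π : E →+ E ⧸ S)
    have hlift : ∀ y ∈ D', ∀ ρ : ℝ, ‖y‖ < ρ → ∃ x ∈ D, π x = y ∧ ‖x‖ ≤ ρ + ‖u‖ / 2 := by
      rintro _ ⟨w, hw, rfl⟩ ρ hρ
      obtain ⟨z, hz, hzρ⟩ := Submodule.Quotient.norm_mk_lt (S := S) (π w) (sub_pos.2 hρ)
      replace hzρ : ‖z‖ < ρ := by
        have : ‖z‖ < ‖π w‖ + (ρ - ‖π w‖) := hzρ
        linarith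
      have hwz : π (w - z) = 0 := by
        rw [map_sub, sub_eq_zero]
        exact hz.symm
      obtain ⟨t, ht⟩ := (hπ0 _).1 hwz
      refine ⟨w - (round t : ℝ) • u, D.sub_mem hw (hzD t), ?_, ?_⟩
      · rw [map_sub, (hπ0 ((round t : ℝ) • u)).2 ⟨_, rfl⟩, sub_zero]
        rfl
      · have : w - (round t : ℝ) • u = z + (t - round t) • u := by
          rw [sub_smul, ht]
          abel
        rw [this]
        exact (norm_add_le _ _).trans (add_le_add hzρ.le (hround t))
    have hfin' : ∀ ρ : ℝ, {y | y ∈ D' ∧ ‖y‖ ≤ ρ}.Finite := by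
      intro ρ
      refine ((hfin (ρ + 1 + ‖u‖ / 2)).image π).subset ?_
      rintro y ⟨hy, hyρ⟩
      obtain ⟨x, hx, hxy, hxρ⟩ := hlift y hy (ρ + 1) (by linarith)
      exact ⟨x, ⟨hx, hxρ⟩, hxy⟩
    -- A functional on the quotient pulls back with no larger norm, so the dual bound is inherited
    -- with the same `R`.
    have hdual' : ∀ ψ : (E ⧸ S) →L[ℝ] ℝ, (∀ x ∈ D', ∃ m : ℤ, ψ x = m) →
        (∃ x ∈ D', ψ x ≠ 0) → 1 ≤ R * ‖ψ‖ := by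
      rintro ψ h1 ⟨_, ⟨x, hx, rfl⟩, hx0⟩
      refine (hdual (ψ.comp π) (fun x hx => h1 _ ⟨x, hx, rfl⟩) ⟨x, hx, hx0⟩).trans ?_
      refine mul_le_mul_of_nonneg_left ?_ hR.le
      refine ContinuousLinearMap.opNorm_le_bound _ (norm_nonneg ψ) fun x => ?_
      exact (ψ.le_opNorm _).trans
        (mul_le_mul_of_nonneg_left (Submodule.Quotient.norm_mk_le S x) (norm_nonneg _))
    have hrank : Module.finrank ℝ (E ⧸ S) = m := by
      have h1 := S.finrank_quotient_add_finrank
      rw [finrank_span_singleton hu0] at h1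
      omega
    have hIH := ih hrank D' hfin' hdual'
    set a : ℝ := 4 ^ m * R with ha
    have ha0 : 0 < a := by positivity
    -- If the image `D'` is zero, then `D` consists of multiples of `u`. A Hahn–Banach norming
    -- functional divided by `‖u‖` is integral on `D`, and the dual bound gives `‖u‖ ≤ R`. Otherwise
    -- some nonzero `y` in `D'` of norm at most `a` lifts to norm at most `2 * a + ‖u‖ / 2`, and
    -- minimality of `u` gives `‖u‖ ≤ 4 * a`.
    have hua : ‖u‖ ≤ 4 * a := by
      by_cases hD' : ∀ y ∈ D', y = 0
      · obtain ⟨f, hf1, hfu⟩ := exists_dual_vector ℝ u hu0'.ne'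
        have h1 := hdual (‖u‖⁻¹ • f) (by
          intro x hx
          obtain ⟨k, rfl⟩ := hmult x hx (hD' _ ⟨x, hx, rfl⟩)
          refine ⟨k, ?_⟩
          rw [smul_apply, map_zsmul, hfu]
          simp only [RCLike.ofReal_real_eq_id, id, smul_eq_mul, zsmul_eq_mul]
          field_simp) ⟨u, huD, by
            rw [smul_apply, hfu]
            simp only [RCLike.ofReal_real_eq_id, id, smul_eq_mul]
            rw [inv_mul_cancel₀ hu0'.ne']
            exact one_ne_zero⟩
        rw [norm_smul, hf1, norm_inv, norm_norm, mul_one, ← div_eq_mul_inv, le_div_iff₀ hu0',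
          one_mul] at h1
        have h4 : (1 : ℝ) ≤ 4 ^ m := one_le_pow₀ (by norm_num)
        nlinarith
      · have : ∃ y ∈ D', ‖y‖ ≤ a ∧ y ≠ 0 := by
          by_contra hcon
          push Not at hcon
          refine hD' fun y hy => ?_
          have hle : AddSubgroup.closure {y | y ∈ D' ∧ ‖y‖ ≤ a} ≤ ⊥ :=
            (AddSubgroup.closure_le _).2 fun z hz => hcon z hz.1 hz.2
          exact hle (hIH hy)
        obtain ⟨y, hy, hya, hy0⟩ := this
        obtain ⟨x, hx, hxy, hxn⟩ := hlift y hy (2 * a) (by linarith)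
        have := humin x hx (by
          rintro rfl
          exact hy0 (by rw [← hxy, map_zero]))
        linarith
    have h4a : (4 : ℝ) ^ (m + 1) * R = 4 * a := by rw [ha]; ring
    rw [h4a]
    set K : Set E := {x | x ∈ D ∧ ‖x‖ ≤ 4 * a} with hK
    have hKD : AddSubgroup.closure K ≤ D := (AddSubgroup.closure_le _).2 fun z hz => hz.1
    have huK : u ∈ AddSubgroup.closure K := AddSubgroup.subset_closure ⟨huD, hua⟩
    -- Lifts of short generators have norm at most `2 * a + ‖u‖ / 2 ≤ 4 * a`; this is the factor 4
    -- lost per dimension.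
    have hD'K : D' ≤ (AddSubgroup.closure K).map (π : E →+ E ⧸ S) := by
      refine hIH.trans ((AddSubgroup.closure_le _).2 ?_)
      rintro y ⟨hy, hya⟩
      obtain ⟨x, hx, hxy, hxn⟩ := hlift y hy (2 * a) (by linarith)
      exact ⟨x, AddSubgroup.subset_closure ⟨hx, by linarith⟩, hxy⟩
    intro x hx
    obtain ⟨k, hk, hkx⟩ := hD'K (AddSubgroup.mem_map_of_mem (π : E →+ E ⧸ S) hx)
    obtain ⟨j, hj⟩ := hmult (x - k) (D.sub_mem hx (hKD hk)) (by
      rw [map_sub, sub_eq_zero]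
      exact hkx.symm)
    rw [← sub_add_cancel x k, hj]
    exact add_mem (zsmul_mem huK j) hk

/-- Simultaneous Dirichlet approximation. -/
theorem exists_nat_forall_abs_sub_lt {ι : Type*} [Fintype ι] (a : ι → ℝ) (Q : ℕ) (hQ : 0 < Q) :
    ∃ k : ℕ, 0 < k ∧ k ≤ Q ^ Fintype.card ι ∧ ∃ z : ι → ℤ, ∀ i, |k * a i - z i| ≤ 1 / Q := by
  classical
  have hQ' : (0 : ℝ) < Q := by exact_mod_cast hQ
  -- Pigeonhole: one more multiple of `a` modulo 1 than there are boxes of side `1 / Q`.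
  let F : Fin (Q ^ Fintype.card ι + 1) → ι → Fin Q := fun k i =>
    ⟨⌊Q * Int.fract ((k : ℕ) * a i)⌋₊, by
      rw [Nat.floor_lt (mul_nonneg hQ'.le (Int.fract_nonneg _))]
      have := Int.fract_lt_one ((k : ℕ) * a i)
      nlinarith⟩
  obtain ⟨k₁, k₂, hne, hF⟩ := Fintype.exists_ne_map_eq_of_card_lt F (by simp)
  wlog hlt : k₁ < k₂ generalizing k₁ k₂
  · exact this k₂ k₁ hne.symm hF.symm (lt_of_le_of_ne (not_lt.1 hlt) hne.symm)
  have hlt' : (k₁ : ℕ) < k₂ := hlt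
  refine ⟨k₂ - k₁, by omega, by omega, fun i => ⌊(k₂ : ℕ) * a i⌋ - ⌊(k₁ : ℕ) * a i⌋, fun i => ?_⟩
  have h : ⌊Q * Int.fract ((k₁ : ℕ) * a i)⌋₊ = ⌊Q * Int.fract ((k₂ : ℕ) * a i)⌋₊ :=
    congrArg Fin.val (congrFun hF i)
  have h1 := Nat.floor_le (mul_nonneg hQ'.le (Int.fract_nonneg ((k₁ : ℕ) * a i)))
  have h2 := Nat.lt_floor_add_one (Q * Int.fract ((k₁ : ℕ) * a i))
  have h3 := Nat.floor_le (mul_nonneg hQ'.le (Int.fract_nonneg ((k₂ : ℕ) * a i)))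
  have h4 := Nat.lt_floor_add_one (Q * Int.fract ((k₂ : ℕ) * a i))
  rw [← h] at h3 h4
  rw [Nat.cast_sub hlt'.le]
  have e : ((k₂ : ℕ) - (k₁ : ℕ) : ℝ) * a i - ((⌊(k₂ : ℕ) * a i⌋ - ⌊(k₁ : ℕ) * a i⌋ : ℤ) : ℝ) =
      Int.fract ((k₂ : ℕ) * a i) - Int.fract ((k₁ : ℕ) * a i) := by
    simp only [Int.fract]
    push_cast
    ring
  rw [e, abs_le, neg_le, le_div_iff₀ hQ', le_div_iff₀ hQ']
  constructor <;> linarith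

variable {V : Type*} [AddCommGroup V] [Module ℝ V]

/-- A lattice vector outside of the span of the short lattice vectors is far away from it. -/
theorem le_mul_of_notMem_span_short [FiniteDimensional ℝ V] (p : Seminorm ℝ V)
    (Λ : AddSubgroup V) {r : ℝ} {x e : V} (hx : x ∈ Λ)
    (hxs : x ∉ Submodule.span ℝ {y | y ∈ Λ ∧ p y ≤ r})
    (he : x - e ∈ Submodule.span ℝ {y | y ∈ Λ ∧ p y ≤ r}) :
    r ≤ 2 * (2 * Module.finrank ℝ V + 2) ^ Module.finrank ℝ V * p e := by
  classical
  set n := Module.finrank ℝ V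
  set s : Set V := {y | y ∈ Λ ∧ p y ≤ r} with hs
  by_contra hlt
  push Not at hlt
  have hr : 0 < r := lt_of_le_of_lt (by positivity) hlt
  obtain ⟨b, hbs, hspan, hb⟩ := exists_linearIndependent ℝ s
  have hbfin : b.Finite := hb.setFinite
  have : Fintype b := hbfin.fintype
  have hcard : Fintype.card b ≤ n := hb.fintype_card_le_finrank
  rw [← hspan] at he
  obtain ⟨a, ha⟩ := (Submodule.mem_span_range_iff_exists_fun ℝ).1
    (show x - e ∈ Submodule.span ℝ (Set.range ((↑) : b → V)) by simpa using he)
  -- Approximate the coordinates of `x - e` in short vectors. With `Q = 2 * n + 2` the rounding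
  -- errors contribute at most `r / 2` to `p y`, and `k ≤ Q ^ n` keeps the contribution of `e` below
  -- `r / 2`. So `y` would be a short lattice vector, which puts `k • x` and then `x` in the span.
  obtain ⟨k, hk0, hkQ, z, hz⟩ := exists_nat_forall_abs_sub_lt a (2 * n + 2) (by omega)
  have hkn : (k : ℝ) ≤ (2 * n + 2) ^ n := by
    have h1 : k ≤ (2 * n + 2) ^ n := hkQ.trans (Nat.pow_le_pow_right (by omega) hcard)
    exact_mod_cast h1
  let y : V := k • x - ∑ i, z i • (i : V)
  have hyΛ : y ∈ Λ := Λ.sub_mem (Λ.nsmul_mem hx _)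
    (Λ.sum_mem fun i _ => Λ.zsmul_mem (hbs i.2).1 _)
  have hy : y = (k : ℝ) • e + ∑ i, ((k : ℝ) * a i - z i) • (i : V) := by
    have h1 : x = e + ∑ i, a i • (i : V) := by rw [ha]; abel
    simp only [y, sub_smul, Finset.sum_sub_distrib, mul_smul, ← Finset.smul_sum, ha,
      Int.cast_smul_eq_zsmul, ← Nat.cast_smul_eq_nsmul ℝ, smul_sub]
    abel
  have hpy : p y ≤ r := by
    have h1 : p y ≤ k * p e + ∑ i : b, p (((k : ℝ) * a i - z i) • (i : V)) := by
      rw [hy]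
      refine (map_add_le_add p _ _).trans (add_le_add ?_ ?_)
      · rw [map_smul_eq_mul]
        simp
      · exact Finset.le_sum_of_subadditive p (map_zero p).le (map_add_le_add p) _ _
    have h2 : ∑ i : b, p (((k : ℝ) * a i - z i) • (i : V)) ≤ n * (1 / (2 * n + 2) * r) := by
      calc _ ≤ ∑ i : b, 1 / (2 * n + 2 : ℝ) * r := by
            refine Finset.sum_le_sum fun i _ => ?_
            rw [map_smul_eq_mul, Real.norm_eq_abs]
            have h3 := hz i
            push_cast at h3
            exact mul_le_mul h3 (hbs i.2).2 (apply_nonneg _ _) (by positivity)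
        _ ≤ _ := by
            rw [Finset.sum_const, Finset.card_univ, nsmul_eq_mul]
            gcongr
    have h3 : (n : ℝ) * (1 / (2 * n + 2) * r) ≤ r / 2 := by
      have : (n : ℝ) * (1 / (2 * n + 2) * r) = n * r / (2 * n + 2) := by ring
      rw [this, div_le_div_iff₀ (by positivity) (by norm_num)]
      nlinarith
    have h4 : k * p e ≤ (2 * n + 2) ^ n * p e :=
      mul_le_mul_of_nonneg_right hkn (apply_nonneg _ _)
    nlinarith
  have hmem : (k : ℝ) • x ∈ Submodule.span ℝ s := by
    have h1 : (k : ℝ) • x = y + ∑ i, z i • (i : V) := by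
      simp only [y, Nat.cast_smul_eq_nsmul ℝ]
      abel
    rw [h1]
    exact add_mem (Submodule.subset_span ⟨hyΛ, hpy⟩)
      (Submodule.sum_mem _ fun i _ => zsmul_mem (Submodule.subset_span (hbs i.2)) _)
  refine hxs ?_
  have hk0' : (k : ℝ) ≠ 0 := by exact_mod_cast hk0.ne'
  have := Submodule.smul_mem _ (k : ℝ)⁻¹ hmem
  rwa [smul_smul, inv_mul_cancel₀ hk0', one_smul] at this

end GeometryOfNumbers

/-! ### Duality for lattices with an integral bilinear form -/

section LatticeDuality

variable {V : Type*} [AddCommGroup V] [Module ℝ V]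

theorem mem_span_int_iff {ι : Type*} (b : Module.Basis ι ℝ V) (x : V) :
    x ∈ Submodule.span ℤ (Set.range b) ↔ ∀ i, ∃ m : ℤ, b.repr x i = m := by
  rw [b.mem_span_iff_repr_mem ℤ x]
  exact forall_congr' fun i => ⟨fun ⟨m, hm⟩ => ⟨m, hm.symm⟩, fun ⟨m, hm⟩ => ⟨m, hm.symm⟩⟩

theorem exists_int_of_mem_span_int {ι : Type*} (b : Module.Basis ι ℝ V) (φ : V →ₗ[ℝ] ℝ)
    (hφ : ∀ i, ∃ m : ℤ, φ (b i) = m) {x : V} (hx : x ∈ Submodule.span ℤ (Set.range b)) :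
    ∃ m : ℤ, φ x = m := by
  induction hx using Submodule.span_induction with
  | mem x h =>
    obtain ⟨i, rfl⟩ := h
    exact hφ i
  | zero => exact ⟨0, by simp⟩
  | add x y _ _ hx hy =>
    obtain ⟨m, hm⟩ := hx
    obtain ⟨k, hk⟩ := hy
    exact ⟨m + k, by rw [map_add, hm, hk]; push_cast; rfl⟩
  | smul c x _ hx =>
    obtain ⟨m, hm⟩ := hx
    exact ⟨c * m, by rw [map_zsmul, hm]; push_cast; simp⟩

/-- An integral functional on a primitive sublattice extends to an integral functional. -/
theorem exists_integral_extension {ι : Type*} [Finite ι] (b : Module.Basis ι ℝ V)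
    (W : Submodule ℝ V) (φ : V →ₗ[ℝ] ℝ)
    (hφ : ∀ x ∈ Submodule.span ℤ (Set.range b), x ∈ W → ∃ m : ℤ, φ x = m) :
    ∃ ψ : V →ₗ[ℝ] ℝ, (∀ i, ∃ m : ℤ, ψ (b i) = m) ∧
      ∀ x ∈ Submodule.span ℤ (Set.range b), x ∈ W → ψ x = φ x := by
  set M : Submodule ℤ V := Submodule.span ℤ (Set.range b) with hM
  have hfin : Module.Finite ℤ M := Module.Finite.of_basis (b.restrictScalars ℤ)
  let D : Submodule ℤ M := (W.restrictScalars ℤ).comap M.subtype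
  -- A lattice point with a nonzero multiple in the real subspace `W` lies in `W`. So the quotient
  -- is torsion-free, hence free, and `D` is a direct summand.
  have htf : Module.IsTorsionFree ℤ (M ⧸ D) := by
    rw [Module.isTorsionFree_iff_smul_eq_zero]
    intro k x hkx
    obtain ⟨x, rfl⟩ := D.mkQ_surjective x
    by_cases hk : k = 0
    · exact Or.inl hk
    · right
      rw [← map_smul, Submodule.mkQ_apply, Submodule.Quotient.mk_eq_zero] at hkx
      rw [Submodule.mkQ_apply, Submodule.Quotient.mk_eq_zero]
      have h1 : (k : ℝ) • (x : V) ∈ W := by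
        rw [Int.cast_smul_eq_zsmul]
        exact hkx
      have h2 := W.smul_mem (k : ℝ)⁻¹ h1
      rwa [smul_smul, inv_mul_cancel₀ (by exact_mod_cast hk), one_smul] at h2
  have hfree : Module.Free ℤ (M ⧸ D) := inferInstance
  obtain ⟨s, hs⟩ := Module.projective_lifting_property D.mkQ LinearMap.id D.mkQ_surjective
  -- Extend by composing `φ` with the projection onto `D` along the chosen section.
  let ψ₀ : M →ₗ[ℤ] ℝ := (φ.restrictScalars ℤ) ∘ₗ M.subtype ∘ₗ (LinearMap.id - s ∘ₗ D.mkQ)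
  have hψ₀ : ∀ x : M, ∃ m : ℤ, ψ₀ x = m := by
    intro x
    refine hφ (x - s (D.mkQ x) : M) (Subtype.mem _) ?_
    have h1 : D.mkQ (x - s (D.mkQ x)) = 0 := by
      rw [map_sub, sub_eq_zero]
      exact (LinearMap.congr_fun hs (D.mkQ x)).symm
    rw [Submodule.mkQ_apply, Submodule.Quotient.mk_eq_zero] at h1
    exact h1
  have hbM : ∀ i, b i ∈ M := fun i => Submodule.subset_span ⟨i, rfl⟩
  let ψ : V →ₗ[ℝ] ℝ := b.constr ℝ fun i => ψ₀ ⟨b i, hbM i⟩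
  have hψ : ∀ x : M, ψ x = ψ₀ x := by
    have h : (ψ.restrictScalars ℤ) ∘ₗ M.subtype = ψ₀ := by
      refine (b.restrictScalars ℤ).ext fun i => ?_
      have e : (b.restrictScalars ℤ i : M) = ⟨b i, hbM i⟩ :=
        Subtype.ext (b.restrictScalars_apply ℤ i)
      rw [e]
      exact b.constr_basis ℝ _ i
    exact fun x => LinearMap.congr_fun h x
  refine ⟨ψ, fun i => ?_, fun x hx hxW => ?_⟩
  · obtain ⟨m, hm⟩ := hψ₀ ⟨b i, hbM i⟩
    exact ⟨m, (hψ ⟨b i, hbM i⟩).trans hm⟩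
  · refine (hψ ⟨x, hx⟩).trans ?_
    have h1 : D.mkQ ⟨x, hx⟩ = 0 := (Submodule.Quotient.mk_eq_zero D).2 hxW
    have h2 : ψ₀ ⟨x, hx⟩ = φ ((⟨x, hx⟩ - s (D.mkQ ⟨x, hx⟩) : M) : V) := rfl
    rw [h2, h1, map_zero, sub_zero]

theorem finite_lattice_inter_ball [FiniteDimensional ℝ V] {n : ℕ} (b : Module.Basis (Fin n) ℝ V)
    (p : Seminorm ℝ V) (hp : ∀ x, p x = 0 → x = 0) (ρ : ℝ) :
    {x | x ∈ Submodule.span ℤ (Set.range b) ∧ p x ≤ ρ}.Finite := by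
  choose c hc0 hc using fun i => exists_forall_abs_le_mul p hp (b.coord i)
  have hf : (Set.univ.pi fun i => Set.Icc (-⌈c i * ρ⌉) ⌈c i * ρ⌉ : Set (Fin n → ℤ)).Finite :=
    Set.Finite.pi fun i => Set.finite_Icc _ _
  refine (hf.image fun z => ∑ i, z i • b i).subset ?_
  rintro x ⟨hx, hxρ⟩
  choose z hz using (mem_span_int_iff b x).1 hx
  refine ⟨z, fun i _ => ?_, ?_⟩
  · have h1 : |(z i : ℝ)| ≤ c i * ρ := by
      rw [← hz i]
      exact (hc i x).trans (mul_le_mul_of_nonneg_left hxρ (hc0 i).le)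
    have h2 : |(z i : ℝ)| ≤ ⌈c i * ρ⌉ := h1.trans (Int.le_ceil _)
    have h3 : |z i| ≤ ⌈c i * ρ⌉ := by exact_mod_cast h2
    exact abs_le.1 h3
  · conv_rhs => rw [← b.sum_repr x]
    exact Finset.sum_congr rfl fun i _ => by rw [hz i, Int.cast_smul_eq_zsmul]

/-- The orthogonal complement of a rational subspace is rational. -/
theorem orthogonal_span_le_span {n : ℕ} (b : Module.Basis (Fin n) ℝ V)
    (B : LinearMap.BilinForm ℝ V) (hint : ∀ i j, ∃ m : ℤ, B (b i) (b j) = m) (s : Set V)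
    (hs : s ⊆ Submodule.span ℤ (Set.range b)) :
    B.orthogonal (Submodule.span ℝ s) ≤ Submodule.span ℝ
      {x | x ∈ Submodule.span ℤ (Set.range b) ∧ x ∈ B.orthogonal (Submodule.span ℝ s)} := by
  intro x hx
  -- In the basis `b` the equations of the orthogonal complement have integer coefficients, so
  -- rational solutions span the real ones.
  let E : Set (Fin n → ℚ) := {a | ∃ w ∈ s, ∀ i, (a i : ℝ) = B w (b i)}
  have hE : ∀ w ∈ s, ∃ a ∈ E, ∀ i, (a i : ℝ) = B w (b i) := by
    intro w hw
    have h1 : ∀ i, ∃ m : ℤ, B w (b i) = m := fun i =>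
      exists_int_of_mem_span_int b (B.flip (b i)) (fun j => hint j i) (hs hw)
    choose m hm using h1
    exact ⟨fun i => m i, ⟨w, hw, fun i => by rw [hm]; simp⟩, fun i => by rw [hm]; simp⟩
  have hBsum : ∀ (w : V) (y : Fin n → ℝ), B w (b.equivFun.symm y) = ∑ i, B w (b i) * y i := by
    intro w y
    rw [b.equivFun_symm_apply, map_sum]
    exact Finset.sum_congr rfl fun i _ => by rw [map_smul, smul_eq_mul, mul_comm]
  have hker := mem_span_algebraMap_of_forall_sum_eq_zero (k := ℚ) E (b.equivFun x) (by
    rintro a ⟨w, hw, ha⟩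
    have h1 : B w x = 0 := LinearMap.BilinForm.mem_orthogonal_iff.1 hx w (Submodule.subset_span hw)
    rw [← b.equivFun.symm_apply_apply x, hBsum] at h1
    rw [← h1]
    exact Finset.sum_congr rfl fun i _ => by rw [← ha i]; rfl)
  have h2 := Submodule.mem_map_of_mem (f := (b.equivFun.symm : (Fin n → ℝ) →ₗ[ℝ] V)) hker
  rw [LinearEquiv.coe_coe, b.equivFun.symm_apply_apply, Submodule.map_span] at h2
  refine Submodule.span_le.2 ?_ h2
  rintro _ ⟨_, ⟨y, hy, rfl⟩, rfl⟩
  set v : V := b.equivFun.symm fun i => algebraMap ℚ ℝ (y i) with hv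
  have hvW : v ∈ B.orthogonal (Submodule.span ℝ s) := by
    rw [LinearMap.BilinForm.mem_orthogonal_iff]
    intro w hw
    change B w v = 0
    induction hw using Submodule.span_induction with
    | mem w hw =>
      obtain ⟨a, haE, ha⟩ := hE w hw
      rw [hv, hBsum]
      have h3 := congrArg (algebraMap ℚ ℝ) (hy a haE)
      rw [map_sum, map_zero] at h3
      rw [← h3]
      exact Finset.sum_congr rfl fun i _ => by rw [← ha i, map_mul]; rfl
    | zero => simp
    | add w w' _ _ h1 h2 => rw [map_add, LinearMap.add_apply, h1, h2, add_zero]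
    | smul c w _ h1 => rw [map_smul, LinearMap.smul_apply, h1, smul_zero]
  -- Clearing denominators moves a rational solution into the lattice.
  let d : ℕ := ∏ i, (y i).den
  have hd : (d : ℝ) ≠ 0 := by
    exact_mod_cast (Finset.prod_pos fun i _ => (y i).den_pos).ne'
  have hdv : (d : ℝ) • v ∈ Submodule.span ℤ (Set.range b) := by
    rw [mem_span_int_iff]
    intro i
    obtain ⟨k, hk⟩ := Finset.dvd_prod_of_mem (fun i => (y i).den) (Finset.mem_univ i)
    refine ⟨k * (y i).num, ?_⟩
    have h4 : b.repr v i = (y i : ℝ) := by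
      rw [← b.equivFun_apply, hv, LinearEquiv.apply_symm_apply]
      rfl
    have h5 : ((d : ℚ) * y i) = k * (y i).num := by
      have : (d : ℚ) = (y i).den * k := by exact_mod_cast hk
      rw [this, mul_comm ((y i).den : ℚ), mul_assoc, Rat.den_mul_eq_num]
    rw [map_smul, Finsupp.smul_apply, h4, smul_eq_mul]
    exact_mod_cast congrArg (fun t : ℚ => (t : ℝ)) h5
  have : v = (d : ℝ)⁻¹ • ((d : ℝ) • v) := by rw [smul_smul, inv_mul_cancel₀ hd, one_smul]
  change v ∈ _
  rw [this]
  exact Submodule.smul_mem _ _ (Submodule.subset_span ⟨hdv, Submodule.smul_mem _ _ hvW⟩)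

/-- The representing vector is `∑ φ (e i) • e' i` for a fixed basis and its dual basis, so the
constant depends only on that basis and on `p`. -/
theorem exists_forall_representation_bound [FiniteDimensional ℝ V] (p : Seminorm ℝ V)
    (B : LinearMap.BilinForm ℝ V) (hB : B.Nondegenerate) :
    ∃ c, 0 < c ∧ ∀ (φ : V →ₗ[ℝ] ℝ) (s : ℝ), (∀ x, |φ x| ≤ s * p x) →
      0 ≤ s → ∃ y, (∀ x, B y x = φ x) ∧ p y ≤ c * s := by
  classical
  let e := Module.finBasis ℝ V
  let e' := B.dualBasis hB e
  refine ⟨∑ i, p (e i) * p (e' i) + 1, ?_, fun φ s hφ hs => ⟨∑ i, φ (e i) • e' i, ?_, ?_⟩⟩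
  · have : 0 ≤ ∑ i, p (e i) * p (e' i) :=
      Finset.sum_nonneg fun i _ => mul_nonneg (apply_nonneg _ _) (apply_nonneg _ _)
    linarith
  · intro x
    have h : B (∑ i, φ (e i) • e' i) = φ := by
      refine e.ext fun j => ?_
      simp only [map_sum, map_smul, LinearMap.sum_apply, LinearMap.smul_apply, smul_eq_mul]
      rw [Finset.sum_eq_single j]
      · rw [LinearMap.BilinForm.apply_dualBasis_left]
        simp
      · intro i _ hij
        rw [LinearMap.BilinForm.apply_dualBasis_left, if_neg hij.symm, mul_zero]
      · simp
    rw [h]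
  · calc p (∑ i, φ (e i) • e' i) ≤ ∑ i, p (φ (e i) • e' i) :=
          Finset.le_sum_of_subadditive p (map_zero p).le (map_add_le_add p) _ _
      _ ≤ ∑ i, p (e i) * p (e' i) * s := by
          refine Finset.sum_le_sum fun i _ => ?_
          rw [map_smul_eq_mul, Real.norm_eq_abs]
          have := mul_le_mul_of_nonneg_right (hφ (e i)) (apply_nonneg p (e' i))
          linarith
      _ ≤ _ := by
          rw [← Finset.sum_mul, add_mul]
          linarith

/-- The discriminant multiplies the dual lattice into the lattice. -/
theorem det_smul_mem_of_integral {n : ℕ} (b : Module.Basis (Fin n) ℝ V)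
    (B : LinearMap.BilinForm ℝ V) (M : Matrix (Fin n) (Fin n) ℤ)
    (hM : ∀ i j, B (b i) (b j) = M i j) {y : V} (hy : ∀ i, ∃ m : ℤ, B y (b i) = m) :
    (M.det : ℝ) • y ∈ Submodule.span ℤ (Set.range b) := by
  choose z hz using hy
  rw [mem_span_int_iff]
  intro i
  -- Cramer's rule: the coordinate row of `y` times `M` is the integer row `z`, and multiplying on
  -- the right by the adjugate leaves `det M` times the coordinates.
  refine ⟨(Matrix.vecMul z M.adjugate) i, ?_⟩
  let Mr : Matrix (Fin n) (Fin n) ℝ := (Int.castRingHom ℝ).mapMatrix M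
  have h1 : Matrix.vecMul (b.equivFun y) Mr = fun j => (z j : ℝ) := by
    funext j
    rw [← hz j]
    conv_rhs => rw [← b.sum_equivFun y]
    simp only [map_sum, map_smul, LinearMap.sum_apply, LinearMap.smul_apply, smul_eq_mul,
      Matrix.vecMul, dotProduct]
    exact Finset.sum_congr rfl fun i _ => by rw [hM]; rfl
  have h2 : Matrix.vecMul (Matrix.vecMul (b.equivFun y) Mr) Mr.adjugate =
      (M.det : ℝ) • b.equivFun y := by
    have hdet : Mr.det = (M.det : ℝ) := (RingHom.map_det (Int.castRingHom ℝ) M).symm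
    rw [Matrix.vecMul_vecMul, Matrix.mul_adjugate, Matrix.vecMul_smul, Matrix.vecMul_one, hdet]
  have h3 : Mr.adjugate = (Int.castRingHom ℝ).mapMatrix M.adjugate :=
    (RingHom.map_adjugate (Int.castRingHom ℝ) M).symm
  rw [h1, h3] at h2
  have h4 := congrFun h2 i
  rw [map_smul, Finsupp.smul_apply, ← b.equivFun_apply]
  refine h4.symm.trans ?_
  simp [Matrix.vecMul, dotProduct]

/-- The lattice vectors orthogonal to the short lattice vectors are generated by vectors of
controlled length, uniformly over all lattices with a given discriminant. -/
theorem exists_forall_orthogonal_le_closure [FiniteDimensional ℝ V] (p : Seminorm ℝ V)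
    (hp : ∀ x, p x = 0 → x = 0)
    (B : LinearMap.BilinForm ℝ V) (hB : B.Nondegenerate) (hsymm : ∀ x y, B x y = B y x)
    (d : ℤ) (hd : d ≠ 0) : ∃ C, 0 < C ∧
      ∀ (b : Module.Basis (Fin (Module.finrank ℝ V)) ℝ V)
        (M : Matrix (Fin (Module.finrank ℝ V)) (Fin (Module.finrank ℝ V)) ℤ),
        (∀ i j, B (b i) (b j) = M i j) → M.det = d →
        ∀ Λ : AddSubgroup V, Submodule.span ℤ (Set.range b) = AddSubgroup.toIntSubmodule Λ →
        ∀ r : ℝ, 0 < r →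
          Λ ⊓ (B.orthogonal (Submodule.span ℝ {y | y ∈ Λ ∧ p y ≤ r})).toAddSubgroup ≤
            AddSubgroup.closure {x | x ∈ Λ ∧
              x ∈ B.orthogonal (Submodule.span ℝ {y | y ∈ Λ ∧ p y ≤ r}) ∧ p x ≤ C / r} := by
  obtain ⟨c, hc0, hc⟩ := exists_forall_representation_bound p B hB
  set n := Module.finrank ℝ V with hn
  let c₂ : ℝ := 2 * (2 * n + 2) ^ n
  have hc₂ : 0 < c₂ := by positivity
  have hd' : 0 < |(d : ℝ)| := abs_pos.2 (by exact_mod_cast hd)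
  -- The factors come from generation under a dual bound, Dirichlet approximation, the discriminant,
  -- and the representation of functionals, in this order.
  refine ⟨4 ^ n * (c₂ * |(d : ℝ)| * c), by positivity, fun b M hM hMd Λ hΛ r hr => ?_⟩
  set 𝔳 : Submodule ℝ V := Submodule.span ℝ {y | y ∈ Λ ∧ p y ≤ r} with h𝔳
  set W := B.orthogonal 𝔳 with hW
  have hmem : ∀ x, x ∈ Submodule.span ℤ (Set.range b) ↔ x ∈ Λ := fun x => by rw [hΛ]; rfl
  have hrefl : B.IsRefl := fun x y h => by rw [← h]; exact hsymm y x
  have hWspan : W ≤ Submodule.span ℝ {x | x ∈ Λ ∧ x ∈ W} := by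
    have := orthogonal_span_le_span b B (fun i j => ⟨M i j, hM i j⟩) {y | y ∈ Λ ∧ p y ≤ r}
      (fun y hy => (hmem y).2 hy.1)
    simpa only [hmem] using this
  let _ := p.normedAddCommGroupOfDefinite hp
  let _ := p.normedSpaceOfDefinite hp
  have key := le_closure_short_of_dual_bound n hn.symm (Λ ⊓ W.toAddSubgroup)
    (fun ρ => (finite_lattice_inter_ball b p hp ρ).subset
      fun x hx => ⟨(hmem x).2 hx.1.1, hx.2⟩) (c₂ * |(d : ℝ)| * c / r) (by positivity) ?_
  · refine key.trans (AddSubgroup.closure_mono ?_)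
    rintro x ⟨hx, hxr⟩
    refine ⟨hx.1, hx.2, ?_⟩
    rw [← mul_div_assoc] at hxr
    exact hxr
  · rintro φ hφint ⟨x₀, ⟨hx₀Λ, hx₀W⟩, hx₀⟩
    -- Two vectors represent `φ` on the lattice points of `W`: `y'`, whose length is controlled by
    -- `‖φ‖`, and below `y`, which comes from an integral extension and lies in the dual lattice.
    obtain ⟨y', hy', hpy'⟩ := hc φ.toLinearMap ‖φ‖ (fun x => φ.le_opNorm x) (norm_nonneg φ)
    obtain ⟨ψ, hψ, hψφ⟩ := exists_integral_extension b W φ.toLinearMap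
      (fun x hx hxW => hφint x ⟨(hmem x).1 hx, hxW⟩)
    let y := (B.toDual hB).symm ψ
    have hy : ∀ x, B y x = ψ x := fun x => LinearMap.BilinForm.apply_toDual_symm_apply ψ x
    have hdy : (d : ℝ) • y ∈ Λ := by
      rw [← hmem, ← hMd]
      exact det_smul_mem_of_integral b B M hM fun i => by rw [hy]; exact hψ i
    -- The two functionals agree on the lattice points of `W`, which span `W`, so the difference
    -- lies in `W^⊥ = 𝔳`.
    have hdiff : y - y' ∈ 𝔳 := by
      rw [← LinearMap.BilinForm.orthogonal_orthogonal hB hrefl 𝔳,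
        LinearMap.BilinForm.mem_orthogonal_iff]
      intro x hx
      have hx' := hWspan hx
      change B x (y - y') = 0
      rw [hsymm, map_sub, LinearMap.sub_apply, sub_eq_zero, hy, hy']
      clear hx
      induction hx' using Submodule.span_induction with
      | mem x hx => exact hψφ x ((hmem x).2 hx.1) hx.2
      | zero => simp
      | add x z _ _ hx hz => rw [map_add, map_add, hx, hz]
      | smul t x _ hx => rw [map_smul, map_smul, hx]
    have hnot : (d : ℝ) • y ∉ 𝔳 := by
      intro hmem𝔳
      have h1 : B ((d : ℝ) • y) x₀ = 0 := LinearMap.BilinForm.mem_orthogonal_iff.1 hx₀W _ hmem𝔳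
      rw [map_smul, LinearMap.smul_apply, hy, hψφ x₀ ((hmem x₀).2 hx₀Λ) hx₀W, smul_eq_mul,
        mul_eq_zero] at h1
      rcases h1 with h1 | h1
      · exact hd (by exact_mod_cast h1)
      · exact hx₀ h1
    -- The lattice vector `d • y` is outside 𝔳 but differs from `d • y'` by an element of 𝔳, so `d •
    -- y'` cannot be short; this bounds `‖φ‖` from below.
    have h2 := le_mul_of_notMem_span_short p Λ (e := (d : ℝ) • y') hdy hnot (by
      rw [← smul_sub]
      exact Submodule.smul_mem _ _ hdiff)
    rw [div_mul_eq_mul_div, le_div_iff₀ hr, one_mul]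
    calc r ≤ c₂ * p ((d : ℝ) • y') := h2
      _ = c₂ * |(d : ℝ)| * p y' := by rw [map_smul_eq_mul, Real.norm_eq_abs]; ring
      _ ≤ c₂ * |(d : ℝ)| * (c * ‖φ‖) := by gcongr
      _ = _ := by ring

end LatticeDuality

/-! ### Nilpotency from traces -/

section Traces

/-- The Fitting projection onto the part where `f` is invertible is a polynomial in `f` without
constant term, so its trace vanishes. In characteristic zero the trace of an idempotent detects its
rank, so that part is zero. -/
theorem Module.End.isNilpotent_of_trace_pow_eq_zero {K V : Type*} [Field K] [CharZero K]
    [AddCommGroup V] [Module K V] [FiniteDimensional K V] (f : Module.End K V)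
    (h : ∀ k : ℕ, LinearMap.trace K V (f ^ (k + 1)) = 0) : IsNilpotent f := by
  have htr : ∀ p : Polynomial K,
      LinearMap.trace K V (Polynomial.aeval f (Polynomial.X * p)) = 0 := by
    intro p
    induction p using Polynomial.induction_on' with
    | add p q hp hq => rw [mul_add, map_add, map_add, hp, hq, add_zero]
    | monomial n a =>
      rw [Polynomial.X_mul_monomial, Polynomial.aeval_monomial, ← Algebra.smul_def, map_smul, h n,
        smul_zero]
  obtain ⟨q, hq, hndvd⟩ := (minpoly K f).exists_eq_pow_rootMultiplicity_mul_and_not_dvd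
    (minpoly.ne_zero (Algebra.IsIntegral.isIntegral f)) 0
  rw [Polynomial.C_0, sub_zero] at hq hndvd
  set k := (minpoly K f).rootMultiplicity 0
  -- The exponent is `k + 1` rather than `k` so that the idempotent `e` below is divisible by `X`
  -- even when `k = 0`.
  have hcop : IsCoprime (Polynomial.X ^ (k + 1)) q :=
    ((Polynomial.prime_X.coprime_iff_not_dvd).2 hndvd).pow_left
  obtain ⟨a, b, hab⟩ := hcop
  have hzero : Polynomial.aeval f (Polynomial.X ^ (k + 1) * q) = 0 := by
    rw [pow_succ', mul_assoc, ← hq, map_mul, minpoly.aeval, mul_zero]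
  set e : Module.End K V := Polynomial.aeval f (a * Polynomial.X ^ (k + 1)) with he
  have hidem : IsIdempotentElem e := by
    have h1 : a * Polynomial.X ^ (k + 1) * (a * Polynomial.X ^ (k + 1)) =
        a * Polynomial.X ^ (k + 1) - a * b * (Polynomial.X ^ (k + 1) * q) := by
      linear_combination a * Polynomial.X ^ (k + 1) * hab
    rw [IsIdempotentElem, he, ← map_mul, h1, map_sub, map_mul _ (a * b), hzero, mul_zero, sub_zero]
  have he0 : e = 0 := by
    refine (LinearMap.IsIdempotentElem.trace_eq_zero_iff hidem).1 ?_
    rw [he, show a * Polynomial.X ^ (k + 1) = Polynomial.X * (a * Polynomial.X ^ k) by ring]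
    exact htr _
  refine ⟨k + 1, ?_⟩
  have h2 : (Polynomial.X : Polynomial K) ^ (k + 1) =
      Polynomial.X ^ (k + 1) * (a * Polynomial.X ^ (k + 1)) +
        b * (Polynomial.X ^ (k + 1) * q) := by
    linear_combination -(Polynomial.X ^ (k + 1)) * hab
  have h3 := congrArg (Polynomial.aeval f) h2
  rwa [map_add, map_mul, map_mul _ b, hzero, ← he, he0, mul_zero, mul_zero, add_zero, map_pow,
    Polynomial.aeval_X] at h3

theorem Matrix.isNilpotent_of_trace_pow_eq_zero {K n : Type*} [Field K] [CharZero K] [Fintype n]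
    [DecidableEq n] (M : Matrix n n K) (h : ∀ k : ℕ, (M ^ (k + 1)).trace = 0) : IsNilpotent M := by
  have h1 : IsNilpotent (Matrix.toLinAlgEquiv' M) :=
    Module.End.isNilpotent_of_trace_pow_eq_zero _ fun k => by
      rw [← map_pow]
      exact (Matrix.trace_toLin'_eq _).trans (h k)
  exact (IsNilpotent.map_iff (Matrix.toLinAlgEquiv' (R := K) (n := n)).injective).1 h1

/-- If all words in `S` have trace zero, the elements of the linear span of `S` are nilpotent. -/
theorem Matrix.isNilpotent_of_mem_span_of_trace {K n : Type*} [Field K] [CharZero K] [Fintype n]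
    [DecidableEq n] (S : Set (Matrix n n K))
    (h : ∀ w ∈ Subsemigroup.closure S, w.trace = 0) {x : Matrix n n K}
    (hx : x ∈ Submodule.span K S) : IsNilpotent x := by
  -- The non-unital algebra generated by `S` is spanned by words, so the trace vanishes on it; it
  -- contains all positive powers of `x`.
  have hadj : ∀ y ∈ NonUnitalAlgebra.adjoin K S, y.trace = 0 := by
    intro y hy
    rw [← NonUnitalSubalgebra.mem_toSubmodule, NonUnitalAlgebra.adjoin_eq_span] at hy
    induction hy using Submodule.span_induction with
    | mem w hw => exact h w hw
    | zero => exact Matrix.trace_zero _ _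
    | add y z _ _ hy hz => rw [Matrix.trace_add, hy, hz, add_zero]
    | smul c y _ hy => rw [Matrix.trace_smul, hy, smul_zero]
  have hxa : x ∈ NonUnitalAlgebra.adjoin K S := by
    have : Submodule.span K S ≤ (NonUnitalAlgebra.adjoin K S).toSubmodule :=
      Submodule.span_le.2 (NonUnitalAlgebra.subset_adjoin K)
    exact this hx
  have hpow : ∀ k : ℕ, x ^ (k + 1) ∈ NonUnitalAlgebra.adjoin K S := by
    intro k
    induction k with
    | zero => simpa using hxa
    | succ k ih =>
      rw [pow_succ]
      exact mul_mem ih hxa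
  exact Matrix.isNilpotent_of_trace_pow_eq_zero x fun k => hadj _ (hpow k)

end Traces

/-! ### Parabolic subalgebras -/

section Parabolic

open LieModule in
-- By Lie's theorem `S` acts by triangular matrices. A nilpotent `y` has zero diagonal, so the
-- product with any `x` is strictly triangular. The induction splits off one common eigenvector at a
-- time.
theorem isNilpotent_toEnd_mul_toEnd {k S : Type*} [Field k] [CharZero k] [IsAlgClosed k]
    [LieRing S] [LieAlgebra k S] [LieAlgebra.IsSolvable S] (n : ℕ) {V : Type*} [AddCommGroup V]
    [Module k V] [LieRingModule S V] [LieModule k S V] [FiniteDimensional k V]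
    (hn : Module.finrank k V = n) (x y : S) (hy : IsNilpotent (toEnd k S V y)) :
    IsNilpotent (toEnd k S V x * toEnd k S V y) := by
  induction n generalizing V with
  | zero =>
    have := Module.finrank_zero_iff.1 hn
    exact ⟨1, LinearMap.ext fun v => Subsingleton.elim _ _⟩
  | succ n ih =>
    have hV : Nontrivial V := Module.nontrivial_of_finrank_pos (R := k) (by omega)
    obtain ⟨χ, hχ⟩ := exists_nontrivial_weightSpace_of_isSolvable k S V
    obtain ⟨⟨v, hv⟩, hv0⟩ := exists_ne (0 : weightSpace V χ)
    rw [mem_weightSpace] at hv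
    replace hv0 : v ≠ 0 := fun h => hv0 (Subtype.ext h)
    have hχy : χ y = 0 := by
      obtain ⟨m, hm⟩ := hy
      have h1 : ∀ j : ℕ, (toEnd k S V y ^ j) v = χ y ^ j • v := by
        intro j
        induction j with
        | zero => simp
        | succ j ih =>
          rw [pow_succ', Module.End.mul_apply, ih, map_smul, toEnd_apply_apply, hv, smul_smul,
            pow_succ]
      have h2 := h1 m
      rw [hm, LinearMap.zero_apply] at h2
      exact eq_zero_of_pow_eq_zero ((smul_eq_zero.1 h2.symm).resolve_right hv0)
    let N : LieSubmodule k S V :=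
      { toSubmodule := Submodule.span k {v}
        lie_mem := by
          intro z w hw
          obtain ⟨c, rfl⟩ := Submodule.mem_span_singleton.1 hw
          rw [lie_smul, hv]
          exact Submodule.smul_mem _ _ (Submodule.smul_mem _ _
            (Submodule.mem_span_singleton_self v)) }
    have hrank : Module.finrank k (V ⧸ N) = n := by
      have h1 := (Submodule.span k {v}).finrank_quotient_add_finrank
      rw [finrank_span_singleton hv0] at h1
      have h2 : Module.finrank k (V ⧸ N) = Module.finrank k (V ⧸ Submodule.span k {v}) := rfl
      omega
    have hmk : ∀ (z : S) (w : V), toEnd k S (V ⧸ N) z (LieSubmodule.Quotient.mk w) =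
      LieSubmodule.Quotient.mk (toEnd k S V z w) := fun z w => rfl
    have hpow : ∀ (j : ℕ) (w : V), (toEnd k S (V ⧸ N) y ^ j) (LieSubmodule.Quotient.mk w) =
        LieSubmodule.Quotient.mk ((toEnd k S V y ^ j) w) := by
      intro j w
      induction j with
      | zero => rfl
      | succ j ih => rw [pow_succ', Module.End.mul_apply, ih, hmk, pow_succ', Module.End.mul_apply]
    have hpow2 : ∀ (j : ℕ) (w : V), ((toEnd k S (V ⧸ N) x * toEnd k S (V ⧸ N) y) ^ j)
        (LieSubmodule.Quotient.mk w) =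
        LieSubmodule.Quotient.mk (((toEnd k S V x * toEnd k S V y) ^ j) w) := by
      intro j w
      induction j with
      | zero => rfl
      | succ j ih =>
        rw [pow_succ', Module.End.mul_apply, ih, Module.End.mul_apply, hmk, hmk, pow_succ',
          Module.End.mul_apply, Module.End.mul_apply]
    have hyq : IsNilpotent (toEnd k S (V ⧸ N) y) := by
      obtain ⟨m, hm⟩ := hy
      refine ⟨m, LinearMap.ext fun w => ?_⟩
      obtain ⟨w, rfl⟩ := LieSubmodule.Quotient.surjective_mk' N w
      refine (hpow m w).trans ?_
      rw [hm]
      rfl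
    obtain ⟨m, hm⟩ := ih hrank hyq
    refine ⟨m + 1, LinearMap.ext fun w => ?_⟩
    have h1 := hpow2 m w
    rw [hm, LinearMap.zero_apply] at h1
    -- Modulo the eigenline the `m`-th power is zero, and `y` kills the eigenline because `χ y = 0`,
    -- so one more factor suffices.
    have h2 : ((toEnd k S V x * toEnd k S V y) ^ m) w ∈ N :=
      LieSubmodule.Quotient.mk_eq_zero'.1 h1.symm
    obtain ⟨c, hc⟩ := Submodule.mem_span_singleton.1 h2
    rw [pow_succ', Module.End.mul_apply, ← hc, map_smul, Module.End.mul_apply,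
      toEnd_apply_apply k S V y, hv, hχy, zero_smul, map_zero, smul_zero]
    rfl

variable {L : Type} [LieRing L] [LieAlgebra ℝ L]

theorem exists_eq_one_tmul_add_I_tmul {V : Type*} [AddCommGroup V] [Module ℝ V] (z : ℂ ⊗[ℝ] V) :
    ∃ a c : V, z = (1 : ℂ) ⊗ₜ a + Complex.I ⊗ₜ c := by
  induction z using TensorProduct.induction_on with
  | zero => exact ⟨0, 0, by simp⟩
  | tmul s v =>
    refine ⟨s.re • v, s.im • v, ?_⟩
    rw [TensorProduct.tmul_smul, TensorProduct.tmul_smul, TensorProduct.smul_tmul',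
      TensorProduct.smul_tmul', ← TensorProduct.add_tmul]
    congr 1
    apply Complex.ext <;> simp
  | add y z hy hz =>
    obtain ⟨a, c, rfl⟩ := hy
    obtain ⟨a', c', rfl⟩ := hz
    exact ⟨a + a', c + c', by rw [TensorProduct.tmul_add, TensorProduct.tmul_add]; abel⟩

/-- The complexification of the inclusion of a Lie subalgebra. -/
noncomputable def LieSubalgebra.complexIncl (K : LieSubalgebra ℝ L) : ℂ ⊗[ℝ] K →ₗ⁅ℂ⁆ ℂ ⊗[ℝ] L :=
  { (K.incl : K →ₗ[ℝ] L).baseChange ℂ with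
    map_lie' := fun {x y} => by
      change (K.incl : K →ₗ[ℝ] L).baseChange ℂ ⁅x, y⁆ =
        ⁅(K.incl : K →ₗ[ℝ] L).baseChange ℂ x, (K.incl : K →ₗ[ℝ] L).baseChange ℂ y⁆
      induction x using TensorProduct.induction_on with
      | zero => simp
      | add x x' hx hx' => rw [add_lie, map_add, map_add, add_lie, hx, hx']
      | tmul s a =>
        induction y using TensorProduct.induction_on with
        | zero =>
          refine (congrArg _ (lie_zero (s ⊗ₜ[ℝ] a : ℂ ⊗[ℝ] K))).trans ?_
          rw [map_zero, lie_zero]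
        | add y y' hy hy' =>
          refine (congrArg _ (lie_add (s ⊗ₜ[ℝ] a : ℂ ⊗[ℝ] K) y y')).trans ?_
          rw [map_add, map_add, lie_add, hy, hy']
        | tmul t c => simp }

variable [FiniteDimensional ℝ L]

/-- The Killing-orthogonal of a subalgebra of ad-nilpotent elements contains a Borel subalgebra
after complexification. -/
theorem isParabolicSubalgebra_of_killingPerp_le (K : LieSubalgebra ℝ L)
    (hK : ∀ x ∈ K, IsNilpotent (LieAlgebra.ad ℝ L x)) (P : LieSubalgebra ℝ L)
    (hP : killingPerp K.toSubmodule ≤ P.toSubmodule) : IsParabolicSubalgebra P := by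
  have hnil : LieModule.IsNilpotent K L :=
    (LieModule.isNilpotent_iff_forall' (R := ℝ)).2 fun x => hK x x.2
  have hKnil : LieRing.IsNilpotent K :=
    (LieAlgebra.isNilpotent_iff_forall (R := ℝ)).2 fun x =>
      K.isNilpotent_ad_of_isNilpotent_ad (hK x x.2)
  have had : ∀ y : ℂ ⊗[ℝ] K, IsNilpotent (LieAlgebra.ad ℂ (ℂ ⊗[ℝ] L) (K.complexIncl y)) := by
    intro y
    have h1 : LieAlgebra.ad ℂ (ℂ ⊗[ℝ] L) (K.complexIncl y) =
        LieModule.toEnd ℂ (ℂ ⊗[ℝ] K) (ℂ ⊗[ℝ] L) y := by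
      induction y using TensorProduct.induction_on with
      | zero => simp
      | add y z hy hz => rw [map_add, map_add, hy, hz, map_add]
      | tmul s x =>
        refine LinearMap.ext fun z => ?_
        induction z using TensorProduct.induction_on with
        | zero => simp
        | add z w hz hw => rw [map_add, map_add, hz, hw]
        | tmul t m => rfl
    rw [h1]
    exact LieModule.isNilpotent_toEnd_of_isNilpotent ℂ (ℂ ⊗[ℝ] K) (ℂ ⊗[ℝ] L) y
  -- The complexification of the nilpotent `K` has solvable image, and the ascending chain condition
  -- gives a maximal solvable subalgebra above it.
  obtain ⟨b, hKb, hb⟩ : ∃ b : LieSubalgebra ℂ (ℂ ⊗[ℝ] L), K.complexIncl.range ≤ b ∧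
      IsBorelSubalgebra b := by
    have hs : {s : LieSubalgebra ℂ (ℂ ⊗[ℝ] L) | LieAlgebra.IsSolvable s ∧
        K.complexIncl.range ≤ s}.Nonempty := ⟨K.complexIncl.range, inferInstance, le_rfl⟩
    obtain ⟨b, ⟨hb1, hb2⟩, hb⟩ :=
      (LieSubalgebra.wellFoundedGT_of_noetherian ℂ (ℂ ⊗[ℝ] L)).wf.has_min _ hs
    refine ⟨b, hb2, hb1, fun c hc hbc => ?_⟩
    by_contra hcb
    exact hb c ⟨hc, hb2.trans hbc⟩ (lt_of_le_not_ge hbc hcb)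
  refine ⟨b, hb, fun z hz => ?_⟩
  have horth : ∀ y ∈ K, killingForm ℂ (ℂ ⊗[ℝ] L) z ((1 : ℂ) ⊗ₜ y) = 0 := by
    intro y hy
    have hyb : (1 : ℂ) ⊗ₜ y ∈ b := hKb ⟨(1 : ℂ) ⊗ₜ ⟨y, hy⟩, rfl⟩
    have hsol : LieAlgebra.IsSolvable b := hb.1
    have h1 := isNilpotent_toEnd_mul_toEnd (k := ℂ) (S := b) (V := ℂ ⊗[ℝ] L) _ rfl
      ⟨z, hz⟩ ⟨(1 : ℂ) ⊗ₜ y, hyb⟩ (had ((1 : ℂ) ⊗ₜ ⟨y, hy⟩))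
    exact (LinearMap.isNilpotent_trace_of_isNilpotent h1).eq_zero
  -- The form is real, so orthogonality to `K` holds for the real and imaginary parts of `z`
  -- separately.
  obtain ⟨a, c, rfl⟩ := exists_eq_one_tmul_add_I_tmul z
  have hac : ∀ y ∈ K, killingForm ℝ L a y = 0 ∧ killingForm ℝ L c y = 0 := by
    intro y hy
    have h1 := horth y hy
    rw [killingForm, LieModule.traceForm_baseChange, map_add, LinearMap.add_apply,
      LinearMap.BilinForm.baseChange_tmul, LinearMap.BilinForm.baseChange_tmul] at h1
    constructor
    · simpa using congrArg Complex.re h1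
    · simpa using congrArg Complex.im h1
  have hmem : ∀ w : L, (∀ y ∈ K, killingForm ℝ L w y = 0) → w ∈ P.toSubmodule := fun w hw =>
    hP (LinearMap.BilinForm.mem_orthogonal_iff.2 fun y hy => by
      rw [killingForm, LieModule.traceForm_comm]
      exact hw y hy)
  exact add_mem (Submodule.tmul_mem_baseChange_of_mem _ (hmem a fun y hy => (hac y hy).1))
    (Submodule.tmul_mem_baseChange_of_mem _ (hmem c fun y hy => (hac y hy).2))

end Parabolic

/-! ### Proper subalgebras -/

section Proper

variable {k L : Type*} [Field k] [LieRing L] [LieAlgebra k L] [FiniteDimensional k L]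

/-- A subspace spanned by `T` generates a proper subalgebra if all short iterated brackets of `T`
with a fixed nonzero vector stay in a solvable subalgebra. -/
theorem lieSpan_ne_top_of_forall_lie_mem [LieAlgebra.HasTrivialRadical k L]
    (K : LieSubalgebra k L) [LieAlgebra.IsSolvable K] (T : Set L) {v : L} (hv : v ≠ 0)
    (S : ℕ → Set L) (hS0 : v ∈ S 0) (hS : ∀ j, ∀ t ∈ T, ∀ u ∈ S j, ⁅t, u⁆ ∈ S (j + 1))
    (hSK : ∀ j ≤ Module.finrank k L, S j ⊆ K) :
    LieSubalgebra.lieSpan k L (Submodule.span k T : Set L) ≠ ⊤ := by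
  intro htop
  -- `U m` contains all brackets of depth at most `m` of elements of `T` with `v`. Its dimension
  -- starts at 1 or more and cannot grow `n + 1` times in a row, so it stabilises at some `m ≤ n`,
  -- while still inside `K`.
  let U : ℕ → Submodule k L := fun m => Submodule.span k {u | ∃ j ≤ m, u ∈ S j}
  have hvU : ∀ m, v ∈ U m := fun m => Submodule.subset_span ⟨0, Nat.zero_le _, hS0⟩
  have hmono : ∀ m, U m ≤ U (m + 1) := fun m =>
    Submodule.span_mono fun u ⟨j, hj, hu⟩ => ⟨j, by omega, hu⟩
  have hlie : ∀ m, ∀ t ∈ T, ∀ u ∈ U m, ⁅t, u⁆ ∈ U (m + 1) := by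
    intro m t ht u hu
    induction hu using Submodule.span_induction with
    | mem u h =>
      obtain ⟨j, hj, hu⟩ := h
      exact Submodule.subset_span ⟨j + 1, by omega, hS j t ht u hu⟩
    | zero => simp
    | add u w _ _ hu hw => rw [lie_add]; exact add_mem hu hw
    | smul c u _ hu => rw [lie_smul]; exact Submodule.smul_mem _ _ hu
  obtain ⟨m, hm, hUm⟩ : ∃ m ≤ Module.finrank k L, U (m + 1) ≤ U m := by
    by_contra hcon
    push Not at hcon
    have hrank : ∀ m ≤ Module.finrank k L + 1, m + 1 ≤ Module.finrank k (U m) := by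
      intro m
      induction m with
      | zero =>
        intro _
        have : Nontrivial (U 0) := ⟨⟨v, hvU 0⟩, 0, fun h => hv (congrArg Subtype.val h)⟩
        exact Module.finrank_pos
      | succ m ih =>
        intro hm
        have h1 := ih (by omega)
        have h2 := Submodule.finrank_lt_finrank_of_lt
          (lt_of_le_not_ge (hmono m) (hcon m (by omega)))
        omega
    have h1 := hrank (Module.finrank k L) (by omega)
    have h2 := Submodule.finrank_le (U (Module.finrank k L))
    omega
  have hUK : U m ≤ K.toSubmodule := Submodule.span_le.2 fun u ⟨j, hj, hu⟩ =>
    hSK j (hj.trans hm) hu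
  -- The stabiliser of `U m` is a subalgebra containing `T`. If `T` generates `L`, then `U m` is an
  -- ideal, solvable because it lies in `K`, and nonzero because it contains `v`.
  let Nm : LieSubalgebra k L :=
    { carrier := {x | ∀ u ∈ U m, ⁅x, u⁆ ∈ U m}
      add_mem' := fun {x y} hx hy u hu => by rw [add_lie]; exact add_mem (hx u hu) (hy u hu)
      zero_mem' := fun u _ => by rw [zero_lie]; exact zero_mem _
      smul_mem' := fun c x hx u hu => by rw [smul_lie]; exact Submodule.smul_mem _ _ (hx u hu)
      lie_mem' := fun {x y} hx hy u hu => by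
        rw [lie_lie]
        exact sub_mem (hx _ (hy u hu)) (hy _ (hx u hu)) }
  have hNm : Nm = ⊤ := by
    rw [eq_top_iff, ← htop, LieSubalgebra.lieSpan_le]
    have : Submodule.span k T ≤ Nm.toSubmodule :=
      Submodule.span_le.2 fun t ht u hu => hUm (hlie m t ht u hu)
    exact this
  let I : LieIdeal k L :=
    { U m with
      lie_mem := fun {x u} hu => by
        have hx : x ∈ Nm := by rw [hNm]; exact LieSubalgebra.mem_top x
        exact hx u hu }
  have hI : LieAlgebra.IsSolvable I := by
    let f : I →ₗ⁅k⁆ K :=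
      { toFun := fun u => ⟨u.1, hUK u.2⟩
        map_add' := fun _ _ => rfl
        map_smul' := fun _ _ => rfl
        map_lie' := fun {_ _} => rfl }
    refine Function.Injective.lieAlgebra_isSolvable (f := f) fun y z h => Subtype.ext ?_
    exact congrArg (fun w : K => (w : L)) h
  have hI0 := LieAlgebra.HasTrivialRadical.eq_bot_of_isSolvable I
  have hvI : v ∈ I := hvU m
  rw [hI0, LieSubmodule.mem_bot] at hvI
  exact hv hvI

end Proper

/-! ### The lattice of integral elements -/

section KillingIntegral

variable {L : Type*} [LieRing L] [LieAlgebra ℝ L] {n : ℕ} (b : Module.Basis (Fin n) ℝ L)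

theorem lie_mem_span_int (hb : ∀ i j, ⁅b i, b j⁆ ∈ Submodule.span ℤ (Set.range b)) {x y : L}
    (hx : x ∈ Submodule.span ℤ (Set.range b)) (hy : y ∈ Submodule.span ℤ (Set.range b)) :
    ⁅x, y⁆ ∈ Submodule.span ℤ (Set.range b) := by
  induction hx using Submodule.span_induction with
  | mem x h =>
    obtain ⟨i, rfl⟩ := h
    induction hy using Submodule.span_induction with
    | mem y h =>
      obtain ⟨j, rfl⟩ := h
      exact hb i j
    | zero => simp
    | add y z _ _ hy hz => rw [lie_add]; exact add_mem hy hz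
    | smul c y _ hy => rw [lie_zsmul]; exact Submodule.smul_mem _ _ hy
  | zero => simp
  | add x z _ _ hx hz => rw [add_lie]; exact add_mem hx hz
  | smul c x _ hx => rw [zsmul_lie]; exact Submodule.smul_mem _ _ hx

/-- In a basis with integral structure constants the operators `ad (b i)` have integer matrices, and
the form is a trace of their products. -/
theorem exists_killingForm_eq_int (hb : ∀ i j, ⁅b i, b j⁆ ∈ Submodule.span ℤ (Set.range b))
    (i j : Fin n) : ∃ m : ℤ, killingForm ℝ L (b i) (b j) = m := by
  have hmem : ∀ k, b k ∈ Submodule.span ℤ (Set.range b) := fun k => Submodule.subset_span ⟨k, rfl⟩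
  have h1 : ∀ k, ∃ m : ℤ, b.repr ⁅b i, ⁅b j, b k⁆⁆ k = m := fun k =>
    (mem_span_int_iff b _).1 (lie_mem_span_int b hb (hmem i) (hb j k)) k
  choose m hm using h1
  refine ⟨∑ k, m k, ?_⟩
  rw [killingForm, LieModule.traceForm_apply_apply, LinearMap.trace_eq_matrix_trace ℝ b,
    Matrix.trace,
    Int.cast_sum]
  refine Finset.sum_congr rfl fun k _ => ?_
  rw [Matrix.diag_apply, LinearMap.toMatrix_apply, ← hm k]
  rfl

end KillingIntegral

/-! ### The real Lie algebra: trivial radical and integral lattice -/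

namespace RatSubgroupSL

variable {N : ℕ} {G : RatSubgroupSL N}

/-- The inclusion `Lie(G)(ℝ) → Lie(G)(ℂ)`. -/
noncomputable def complexify (x : G.lieAlgebra ℝ) : G.lieAlgebra ℂ :=
  ⟨(x : Matrix (Fin N) (Fin N) ℝ).map (algebraMap ℝ ℂ),
    IsTangent.map G (RingHom.toRatAlgHom (algebraMap ℝ ℂ)) x.2⟩

theorem complexify_lie (x y : G.lieAlgebra ℝ) :
    complexify ⁅x, y⁆ = ⁅complexify x, complexify y⁆ := by
  apply Subtype.ext
  change ((x : Matrix (Fin N) (Fin N) ℝ) * (y : Matrix (Fin N) (Fin N) ℝ) -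
    (y : Matrix (Fin N) (Fin N) ℝ) * (x : Matrix (Fin N) (Fin N) ℝ)).map (algebraMap ℝ ℂ) =
    (x : Matrix (Fin N) (Fin N) ℝ).map (algebraMap ℝ ℂ) *
      (y : Matrix (Fin N) (Fin N) ℝ).map (algebraMap ℝ ℂ) -
    (y : Matrix (Fin N) (Fin N) ℝ).map (algebraMap ℝ ℂ) *
      (x : Matrix (Fin N) (Fin N) ℝ).map (algebraMap ℝ ℂ)
  rw [Matrix.map_sub _ (map_sub _), Matrix.map_mul, Matrix.map_mul]

theorem span_range_complexify :
    Submodule.span ℂ (Set.range (complexify : G.lieAlgebra ℝ → G.lieAlgebra ℂ)) = ⊤ := by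
  rw [eq_top_iff]
  intro z _
  have h := G.mem_span_of_isTangent (k := ℝ) z.2
  have h2 : (z : Matrix (Fin N) (Fin N) ℂ) ∈ (Submodule.span ℂ
      (Set.range (complexify : G.lieAlgebra ℝ → G.lieAlgebra ℂ))).map
        (G.lieAlgebra ℂ).toSubmodule.subtype := by
    rw [Submodule.map_span]
    refine Submodule.span_mono ?_ h
    rintro _ ⟨Y, hY, rfl⟩
    exact ⟨complexify ⟨Y, hY⟩, ⟨_, rfl⟩, rfl⟩
  obtain ⟨w, hw, hwz⟩ := h2
  rwa [← show w = z from Subtype.ext hwz]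

/-- The complex span of a real abelian ideal is an abelian ideal of the complex Lie algebra, hence
zero. -/
theorem hasTrivialRadical_real (hG : G.IsSemisimple) :
    LieAlgebra.HasTrivialRadical ℝ (G.lieAlgebra ℝ) := by
  rw [LieAlgebra.hasTrivialRadical_iff_no_abelian_ideals]
  intro I hI
  have := hasTrivialRadical_complex hG
  let J : LieIdeal ℂ (G.lieAlgebra ℂ) :=
    { toSubmodule := Submodule.span ℂ (complexify '' (I : Set (G.lieAlgebra ℝ)))
      lie_mem := by
        intro z w hw
        have hz : z ∈ Submodule.span ℂ (Set.range (complexify : G.lieAlgebra ℝ → _)) := by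
          rw [span_range_complexify]
          trivial
        change ⁅z, w⁆ ∈ Submodule.span ℂ (complexify '' (I : Set (G.lieAlgebra ℝ)))
        replace hw : w ∈ Submodule.span ℂ (complexify '' (I : Set (G.lieAlgebra ℝ))) := hw
        induction hz using Submodule.span_induction with
        | mem z h =>
          obtain ⟨x, rfl⟩ := h
          induction hw using Submodule.span_induction with
          | mem w h =>
            obtain ⟨y, hy, rfl⟩ := h
            rw [← complexify_lie]
            exact Submodule.subset_span ⟨_, lie_mem_right ℝ _ I x y hy, rfl⟩
          | zero => simp
          | add w u _ _ hw hu => rw [lie_add]; exact add_mem hw hu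
          | smul c w _ hw => rw [lie_smul]; exact Submodule.smul_mem _ _ hw
        | zero => simp
        | add z u _ _ hz hu => rw [add_lie]; exact add_mem hz hu
        | smul c z _ hz => rw [smul_lie]; exact Submodule.smul_mem _ _ hz }
  have hcomm : ∀ z ∈ J, ∀ w ∈ J, ⁅z, w⁆ = 0 := by
    intro z hz w hw
    replace hz : z ∈ Submodule.span ℂ (complexify '' (I : Set (G.lieAlgebra ℝ))) := hz
    replace hw : w ∈ Submodule.span ℂ (complexify '' (I : Set (G.lieAlgebra ℝ))) := hw
    induction hz using Submodule.span_induction with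
    | mem z h =>
      obtain ⟨x, hx, rfl⟩ := h
      induction hw using Submodule.span_induction with
      | mem w h =>
        obtain ⟨y, hy, rfl⟩ := h
        rw [← complexify_lie]
        have h1 : (⁅(⟨x, hx⟩ : I), (⟨y, hy⟩ : I)⁆ : I) = 0 := hI.trivial _ _
        have h2 : ⁅x, y⁆ = 0 := congrArg Subtype.val h1
        rw [h2]
        exact Subtype.ext ((algebraMap ℝ ℂ).mapMatrix.map_zero)
      | zero => simp
      | add w u _ _ hw hu => rw [lie_add, hw, hu, add_zero]
      | smul c w _ hw => rw [lie_smul, hw, smul_zero]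
    | zero => simp
    | add z u _ _ hz hu => rw [add_lie, hz, hu, add_zero]
    | smul c z _ hz => rw [smul_lie, hz, smul_zero]
  have hJ : IsLieAbelian J := ⟨fun z w => Subtype.ext (hcomm z.1 z.2 w.1 w.2)⟩
  have hJ0 := (LieAlgebra.hasTrivialRadical_iff_no_abelian_ideals (R := ℂ)
    (L := G.lieAlgebra ℂ)).1 this J hJ
  rw [eq_bot_iff]
  intro x hx
  have h1 : complexify x ∈ J := Submodule.subset_span ⟨x, hx, rfl⟩
  rw [hJ0, LieSubmodule.mem_bot] at h1
  rw [LieSubmodule.mem_bot]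
  apply Subtype.ext
  ext i j
  have h2 := congrArg (fun z : G.lieAlgebra ℂ => (z : Matrix (Fin N) (Fin N) ℂ) i j) h1
  exact (algebraMap ℝ ℂ).injective (h2.trans (map_zero _).symm)

theorem exists_nat_mul_eq_int (Y : Matrix (Fin N) (Fin N) ℚ) :
    ∃ d : ℕ, d ≠ 0 ∧ ∃ Z : Matrix (Fin N) (Fin N) ℤ, ∀ i j, (d : ℚ) * Y i j = Z i j := by
  let d : ℕ := ∏ ij : Fin N × Fin N, (Y ij.1 ij.2).den
  have hdvd : ∀ i j, ∃ k, d = (Y i j).den * k := fun i j =>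
    Finset.dvd_prod_of_mem (fun ij : Fin N × Fin N => (Y ij.1 ij.2).den) (Finset.mem_univ (i, j))
  choose k hk using hdvd
  refine ⟨d, (Finset.prod_pos fun ij _ => (Y ij.1 ij.2).den_pos).ne',
    Matrix.of fun i j => k i j * (Y i j).num, fun i j => ?_⟩
  have : (d : ℚ) = (Y i j).den * k i j := by exact_mod_cast hk i j
  rw [this, mul_comm ((Y i j).den : ℚ), mul_assoc, Rat.den_mul_eq_num]
  simp

/-- The Lie algebra is spanned by its rational points, and each of them has a nonzero integral
multiple. -/
theorem span_intLattice : Submodule.span ℝ (G.intLattice : Set (G.lieAlgebra ℝ)) = ⊤ := by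
  rw [eq_top_iff]
  intro z _
  have h := G.mem_span_of_isTangent (k := ℚ) z.2
  have h2 : (z : Matrix (Fin N) (Fin N) ℝ) ∈ (Submodule.span ℝ
      (G.intLattice : Set (G.lieAlgebra ℝ))).map (G.lieAlgebra ℝ).toSubmodule.subtype := by
    refine Submodule.span_le.2 ?_ h
    rintro _ ⟨Y, hY, rfl⟩
    obtain ⟨d, hd, Z, hZ⟩ := exists_nat_mul_eq_int Y
    have hd' : (d : ℝ) ≠ 0 := by exact_mod_cast hd
    let y : G.lieAlgebra ℝ := ⟨Y.map (algebraMap ℚ ℝ), IsTangent.map G (Algebra.ofId ℚ ℝ) hY⟩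
    have hdy : (d : ℝ) • y ∈ G.intLattice := by
      refine ⟨Z, ?_⟩
      ext i j
      change (d : ℝ) * (Y i j : ℝ) = (Z i j : ℝ)
      exact_mod_cast congrArg (fun t : ℚ => (t : ℝ)) (hZ i j)
    refine ⟨y, ?_, rfl⟩
    have : y = (d : ℝ)⁻¹ • ((d : ℝ) • y) := by rw [smul_smul, inv_mul_cancel₀ hd', one_smul]
    rw [this]
    exact Submodule.smul_mem _ _ (Submodule.subset_span hdy)
  obtain ⟨w, hw, hwz⟩ := h2
  rwa [← show w = z from Subtype.ext hwz]

theorem lie_mem_intLattice {x y : G.lieAlgebra ℝ} (hx : x ∈ G.intLattice)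
    (hy : y ∈ G.intLattice) : ⁅x, y⁆ ∈ G.intLattice := by
  obtain ⟨Z, hZ⟩ := hx
  obtain ⟨W, hW⟩ := hy
  refine ⟨Z * W - W * Z, ?_⟩
  rw [LieSubalgebra.coe_bracket, Ring.lie_def, hZ, hW]
  change (Int.castRingHom ℝ).mapMatrix Z * (Int.castRingHom ℝ).mapMatrix W -
    (Int.castRingHom ℝ).mapMatrix W * (Int.castRingHom ℝ).mapMatrix Z =
    (Int.castRingHom ℝ).mapMatrix (Z * W - W * Z)
  rw [map_sub, map_mul, map_mul]

theorem finite_intLattice_inter_ball (P : Seminorm ℝ (Matrix (Fin N) (Fin N) ℝ))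
    (hP : ∀ x, P x = 0 → x = 0) (ρ : ℝ) :
    {x : G.lieAlgebra ℝ | x ∈ G.intLattice ∧ P (x : Matrix (Fin N) (Fin N) ℝ) ≤ ρ}.Finite := by
  choose c hc0 hc using fun ij : Fin N × Fin N =>
    exists_forall_abs_le_mul P hP (Matrix.entryLinearMap ℝ ℝ ij.1 ij.2)
  have hf : (Set.univ.pi fun ij => Set.Icc (-⌈c ij * ρ⌉) ⌈c ij * ρ⌉ :
      Set (Fin N × Fin N → ℤ)).Finite := Set.Finite.pi fun i => Set.finite_Icc _ _
  refine Set.Finite.of_finite_image (f := (Subtype.val : G.lieAlgebra ℝ → _))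
    ((hf.image fun z => Matrix.of fun i j => (z (i, j) : ℝ)).subset ?_)
    Subtype.val_injective.injOn
  rintro _ ⟨x, ⟨⟨Z, hZ⟩, hxρ⟩, rfl⟩
  refine ⟨fun ij => Z ij.1 ij.2, fun ij _ => ?_, ?_⟩
  · have h1 : |(Z ij.1 ij.2 : ℝ)| ≤ c ij * ρ := by
      have h2 := hc ij (x : Matrix (Fin N) (Fin N) ℝ)
      have h3 : Matrix.entryLinearMap ℝ ℝ ij.1 ij.2 (x : Matrix (Fin N) (Fin N) ℝ) =
          (Z ij.1 ij.2 : ℝ) := by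
        rw [hZ]
        rfl
      rw [h3] at h2
      exact h2.trans (mul_le_mul_of_nonneg_left hxρ (hc0 ij).le)
    have h2 : |(Z ij.1 ij.2 : ℝ)| ≤ ⌈c ij * ρ⌉ := h1.trans (Int.le_ceil _)
    have h3 : |Z ij.1 ij.2| ≤ ⌈c ij * ρ⌉ := by exact_mod_cast h2
    exact abs_le.1 h3
  · rw [hZ]
    rfl

theorem Ad_apply_eq (g : G.points ℝ) (x : G.lieAlgebra ℝ) : G.Ad g x = G.adEquiv g x := rfl

theorem lie_mem_latticeAt {g : G.points ℝ} {x y : G.lieAlgebra ℝ} (hx : x ∈ G.latticeAt g)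
    (hy : y ∈ G.latticeAt g) : ⁅x, y⁆ ∈ G.latticeAt g := by
  obtain ⟨x, hx, rfl⟩ := hx
  obtain ⟨y, hy, rfl⟩ := hy
  exact ⟨⁅x, y⁆, lie_mem_intLattice hx hy, (G.adEquiv g).map_lie x y⟩

/-- `Ad(g)` carries a basis of the integral lattice to a basis of the translated lattice. -/
theorem span_map_basis_eq_latticeAt {n : ℕ} (b : Module.Basis (Fin n) ℝ (G.lieAlgebra ℝ))
    (hb : Submodule.span ℤ (Set.range b) = AddSubgroup.toIntSubmodule G.intLattice)
    (g : G.points ℝ) :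
    Submodule.span ℤ (Set.range (b.map (G.adEquiv g).toLinearEquiv)) =
      AddSubgroup.toIntSubmodule (G.latticeAt g) := by
  have h1 : Set.range (b.map (G.adEquiv g).toLinearEquiv) =
      ((G.Ad g).restrictScalars ℤ) '' Set.range b := by
    rw [← Set.range_comp]
    rfl
  rw [h1, ← Submodule.map_span, hb]
  rfl

/-- Words in short vectors of the translated lattice have trace zero. -/
theorem isNilpotent_of_mem_span_short (P : Seminorm ℝ (Matrix (Fin N) (Fin N) ℝ)) {cm ct r : ℝ}
    (hcm : ∀ x y, P (x * y) ≤ cm * (P x * P y)) (hcm0 : 0 < cm)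
    (hct : ∀ x : Matrix (Fin N) (Fin N) ℝ, |x.trace| ≤ ct * P x) (hct0 : 0 < ct)
    (hr : 0 < r) (hrm : cm * r ≤ 1) (hrt : ct * r < 1) (g : G.points ℝ) {x : G.lieAlgebra ℝ}
    (hx : x ∈ Submodule.span ℝ {y : G.lieAlgebra ℝ | y ∈ G.latticeAt g ∧
      P (y : Matrix (Fin N) (Fin N) ℝ) ≤ r}) :
    IsNilpotent (x : Matrix (Fin N) (Fin N) ℝ) := by
  set S : Set (G.lieAlgebra ℝ) := {y | y ∈ G.latticeAt g ∧ P (y : Matrix (Fin N) (Fin N) ℝ) ≤ r}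
  set γ : Matrix (Fin N) (Fin N) ℝ := (g.1 : Matrix (Fin N) (Fin N) ℝ)
  set γ' : Matrix (Fin N) (Fin N) ℝ :=
    ((g.1⁻¹ : Matrix.SpecialLinearGroup (Fin N) ℝ) : Matrix (Fin N) (Fin N) ℝ)
  have hγ : γ' * γ = 1 := by
    rw [← Matrix.SpecialLinearGroup.coe_mul, inv_mul_cancel, Matrix.SpecialLinearGroup.coe_one]
  refine Matrix.isNilpotent_of_mem_span_of_trace
    ((fun y : G.lieAlgebra ℝ => (y : Matrix (Fin N) (Fin N) ℝ)) '' S) ?_ ?_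
  -- Both properties survive multiplication: the inner factors `γ' * γ` cancel, and `cm * r ≤ 1`
  -- keeps the length at most `r`. The trace is then an integer of absolute value less than 1.
  · have key : ∀ w ∈ Subsemigroup.closure
        ((fun y : G.lieAlgebra ℝ => (y : Matrix (Fin N) (Fin N) ℝ)) '' S),
        (∃ Z : Matrix (Fin N) (Fin N) ℤ, w = γ * (Int.castRingHom ℝ).mapMatrix Z * γ') ∧
          P w ≤ r := by
      intro w hw
      induction hw using Subsemigroup.closure_induction with
      | mem w h =>
        obtain ⟨y, ⟨⟨z, ⟨Z, hZ⟩, rfl⟩, hyr⟩, rfl⟩ := h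
        refine ⟨⟨Z, ?_⟩, hyr⟩
        change γ * (z : Matrix (Fin N) (Fin N) ℝ) * γ' = _
        rw [hZ]
        rfl
      | mul w u _ _ hw hu =>
        obtain ⟨⟨Z, hZ⟩, hwr⟩ := hw
        obtain ⟨⟨Y, hY⟩, hur⟩ := hu
        refine ⟨⟨Z * Y, ?_⟩, ?_⟩
        · rw [hZ, hY, map_mul]
          calc γ * (Int.castRingHom ℝ).mapMatrix Z * γ' * (γ * (Int.castRingHom ℝ).mapMatrix Y * γ')
              = γ * (Int.castRingHom ℝ).mapMatrix Z * (γ' * γ) *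
                (Int.castRingHom ℝ).mapMatrix Y * γ' := by simp only [mul_assoc]
            _ = _ := by rw [hγ, mul_one]; simp only [mul_assoc]
        · calc P (w * u) ≤ cm * (P w * P u) := hcm w u
            _ ≤ cm * (r * r) := by
              gcongr
            _ = cm * r * r := by ring
            _ ≤ 1 * r := by gcongr
            _ = r := one_mul r
    intro w hw
    obtain ⟨⟨Z, hZ⟩, hwr⟩ := key w hw
    have htr : w.trace = (Z.trace : ℝ) := by
      rw [hZ, Matrix.trace_mul_comm, ← mul_assoc, hγ, one_mul]
      exact (AddMonoidHom.map_trace (Int.castRingHom ℝ).toAddMonoidHom Z).symm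
    have h1 : |w.trace| < 1 :=
      ((hct w).trans (mul_le_mul_of_nonneg_left hwr hct0.le)).trans_lt hrt
    rw [htr] at h1 ⊢
    have h2 : |Z.trace| < 1 := by exact_mod_cast h1
    rw [Int.abs_lt_one_iff.1 h2, Int.cast_zero]
  · have h1 := Submodule.mem_map_of_mem (f := (G.lieAlgebra ℝ).toSubmodule.subtype) hx
    rw [Submodule.map_span] at h1
    exact h1

end RatSubgroupSL

/-- If the set of generators is bracket-closed, its linear span is the Lie subalgebra it
generates. -/
theorem toSubmodule_lieSpan_eq_span {k L : Type*} [CommRing k] [LieRing L] [LieAlgebra k L]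
    {S : Set L} (hS : ∀ x ∈ S, ∀ y ∈ S, ⁅x, y⁆ ∈ S) :
    (LieSubalgebra.lieSpan k L S).toSubmodule = Submodule.span k S := by
  refine le_antisymm ?_ (Submodule.span_le.2 LieSubalgebra.subset_lieSpan)
  let K : LieSubalgebra k L :=
    { Submodule.span k S with
      lie_mem' := by
        intro x y hx hy
        replace hx : x ∈ Submodule.span k S := hx
        replace hy : y ∈ Submodule.span k S := hy
        change ⁅x, y⁆ ∈ Submodule.span k S
        induction hx using Submodule.span_induction with
        | mem x hx =>
          induction hy using Submodule.span_induction with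
          | mem y hy => exact Submodule.subset_span (hS x hx y hy)
          | zero => simp
          | add y z _ _ hy hz => rw [lie_add]; exact add_mem hy hz
          | smul c y _ hy => rw [lie_smul]; exact Submodule.smul_mem _ _ hy
        | zero => simp
        | add x z _ _ hx hz => rw [add_lie]; exact add_mem hx hz
        | smul c x _ hx => rw [smul_lie]; exact Submodule.smul_mem _ _ hx }
  have h : LieSubalgebra.lieSpan k L S ≤ K :=
    LieSubalgebra.lieSpan_le.2 Submodule.subset_span
  exact h

/-! ### The main theorem -/

theorem mainTheorem9 (N : ℕ) (G : RatSubgroupSL N) (hG : G.IsSemisimple)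
    (q : QuadraticForm ℝ (Matrix (Fin N) (Fin N) ℝ)) (hq : q.PosDef) :
    ∃ δ₀ C : ℝ, 0 < δ₀ ∧ 0 < C ∧
      ∀ δ : ℝ, 0 < δ → δ ≤ δ₀ → ∀ g : G.points ℝ,
        (∃ v ∈ G.intLattice, v ≠ 0 ∧ G.euclNorm q (G.Ad g v) ≤ δ) →
        ∀ (𝔳 : LieSubalgebra ℝ (G.lieAlgebra ℝ)) (W : Submodule ℝ (G.lieAlgebra ℝ))
          (T : Set (G.lieAlgebra ℝ)) (𝔭 : LieSubalgebra ℝ (G.lieAlgebra ℝ)),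
          𝔳 = G.shortSubalgebra q g (δ ^ (1 / C)) →
          W = killingPerp 𝔳.toSubmodule →
          T = {x | x ∈ G.latticeAt g ∧ x ∈ W ∧ G.euclNorm q x ≤ C * δ ^ (-(1 / C))} →
          𝔭 = LieSubalgebra.lieSpan ℝ (G.lieAlgebra ℝ) (W : Set (G.lieAlgebra ℝ)) →
          -- the short vectors generate a nilpotent subalgebra, made of nilpotent matrices
          (LieRing.IsNilpotent 𝔳 ∧ ∀ x ∈ 𝔳, IsNilpotent (x : Matrix (Fin N) (Fin N) ℝ)) ∧
          -- the vectors in `T` span the orthogonal complement and its lattice points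
          (Submodule.span ℝ T = W ∧
            AddSubgroup.closure T = G.latticeAt g ⊓ W.toAddSubgroup) ∧
          -- the orthogonal complement generates a proper parabolic subalgebra
          (𝔭 ≠ ⊤ ∧ IsParabolicSubalgebra 𝔭) := by
  have hrad := RatSubgroupSL.hasTrivialRadical_real hG
  obtain ⟨P, hPq, hP⟩ := exists_seminorm_eq_sqrt q hq
  let p : Seminorm ℝ (G.lieAlgebra ℝ) := P.comp (G.lieAlgebra ℝ).toSubmodule.subtype
  have hp : ∀ x, p x = 0 → x = 0 := fun x hx => Subtype.ext (hP _ hx)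
  have hpq : ∀ x, G.euclNorm q x = p x := fun x => (hPq _).symm
  set n := Module.finrank ℝ (G.lieAlgebra ℝ) with hn
  -- the constants
  obtain ⟨cb, hcb0, hcb'⟩ := exists_forall_map₂_le_mul p hp p hp p
    (LieAlgebra.ad ℝ (G.lieAlgebra ℝ) : G.lieAlgebra ℝ →ₗ[ℝ] Module.End ℝ (G.lieAlgebra ℝ))
  have hcb : ∀ x y : G.lieAlgebra ℝ, p ⁅x, y⁆ ≤ cb * (p x * p y) := hcb'
  obtain ⟨cm, hcm0, hcm⟩ := exists_forall_map₂_le_mul P hP P hP P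
    (LinearMap.mul ℝ (Matrix (Fin N) (Fin N) ℝ))
  obtain ⟨ct, hct0, hct⟩ := exists_forall_abs_le_mul P hP (Matrix.traceLinearMap (Fin N) ℝ ℝ)
  obtain ⟨b, hb⟩ := exists_basis_closure_eq p hp G.intLattice
    (RatSubgroupSL.finite_intLattice_inter_ball P hP) RatSubgroupSL.span_intLattice
  have hbmem : ∀ i, b i ∈ G.intLattice := fun i => by
    have h : b i ∈ Submodule.span ℤ (Set.range b) := Submodule.subset_span ⟨i, rfl⟩
    rw [hb] at h
    exact h
  have hint := exists_killingForm_eq_int b fun i j => by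
    rw [hb]
    exact RatSubgroupSL.lie_mem_intLattice (hbmem i) (hbmem j)
  choose M hM using hint
  have hB := LieAlgebra.IsKilling.killingForm_nondegenerate ℝ (G.lieAlgebra ℝ)
  have hdet : (Matrix.of M).det ≠ 0 := by
    have h1 := (LinearMap.BilinForm.nondegenerate_iff_det_ne_zero b).1 hB
    have h2 : LinearMap.BilinForm.toMatrix b (killingForm ℝ (G.lieAlgebra ℝ)) =
        (Int.castRingHom ℝ).mapMatrix (Matrix.of M) := by
      ext i j
      rw [LinearMap.BilinForm.toMatrix_apply, hM]
      rfl
    rw [h2, ← RingHom.map_det] at h1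
    intro h3
    exact h1 (by rw [h3, map_zero])
  obtain ⟨C₁, hC₁0, hC₁⟩ := exists_forall_orthogonal_le_closure p hp
    (killingForm ℝ (G.lieAlgebra ℝ)) hB
    (fun x y => LieModule.traceForm_comm ℝ (G.lieAlgebra ℝ) (G.lieAlgebra ℝ) x y) _ hdet
  -- `C ≥ C₁` serves the bound on generators of the orthogonal lattice; `C ≥ n + 2` makes `δ = r ^
  -- C` at most `r ^ (n + 2)`.
  let C : ℝ := C₁ + n + 2
  have hC0 : 0 < C := by positivity
  have hCC₁ : C₁ ≤ C := by
    have : (0 : ℝ) ≤ n := by positivity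
    simp only [C]
    linarith
  have hCn : ((n + 2 : ℕ) : ℝ) ≤ C := by
    simp only [C]
    push_cast
    linarith
  -- Bracketing with a vector of length at most `C / r` multiplies lengths by at most `A / r`; the
  -- summand 1 gives `A / r ≥ 1`.
  let A : ℝ := 1 + cb * C
  have hA1 : 1 ≤ A := by
    have : 0 < cb * C := by positivity
    simp only [A]
    linarith
  have hA0 : 0 < A := by linarith
  -- The choice `δ₀ = H⁻¹ ^ C` means `r * H ≤ 1`, which yields all the smallness conditions on `r`
  -- at once, including the strict `ct * r < 1`.
  let H : ℝ := 1 + cb + cm + ct + A ^ n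
  have hAn : 0 < A ^ n := by positivity
  have hH0 : 0 < H := by positivity
  refine ⟨H⁻¹ ^ C, C, by positivity, hC0, ?_⟩
  intro δ hδ0 hδ g hv 𝔳 W T 𝔭 h𝔳 hW hT h𝔭
  set r : ℝ := δ ^ (1 / C) with hr
  have hr0 : 0 < r := by positivity
  have hrH : r * H ≤ 1 := by
    have h1 : r ≤ (H⁻¹ ^ C) ^ (1 / C) := Real.rpow_le_rpow hδ0.le hδ (by positivity)
    rw [← Real.rpow_mul (by positivity), mul_one_div_cancel hC0.ne', Real.rpow_one] at h1
    calc r * H ≤ H⁻¹ * H := by gcongr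
      _ = 1 := inv_mul_cancel₀ hH0.ne'
  have hrH' : r + r * cb + r * cm + r * ct + r * A ^ n ≤ 1 := by
    refine le_trans (le_of_eq ?_) hrH
    simp only [H]
    ring
  have hrcb := mul_pos hr0 hcb0
  have hrcm := mul_pos hr0 hcm0
  have hrct := mul_pos hr0 hct0
  have hrA := mul_pos hr0 hAn
  have hr1 : r ≤ 1 := by linarith
  have hδr : δ = r ^ C := by
    rw [hr, ← Real.rpow_mul hδ0.le, one_div_mul_cancel hC0.ne', Real.rpow_one]
  have hδn : δ ≤ r ^ (n + 2) := by
    rw [hδr, ← Real.rpow_natCast]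
    exact Real.rpow_le_rpow_of_exponent_ge hr0 hr1 hCn
  have hδinv : C * δ ^ (-(1 / C)) = C / r := by
    rw [Real.rpow_neg hδ0.le, ← hr, div_eq_mul_inv]
  -- the span of the short vectors
  set Λ := G.latticeAt g with hΛ
  set S : Set (G.lieAlgebra ℝ) := {y | y ∈ Λ ∧ p y ≤ r} with hS
  have hSlie : ∀ x ∈ S, ∀ y ∈ S, ⁅x, y⁆ ∈ S := by
    rintro x ⟨hx, hxr⟩ y ⟨hy, hyr⟩
    refine ⟨RatSubgroupSL.lie_mem_latticeAt hx hy, ?_⟩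
    calc p ⁅x, y⁆ ≤ cb * (p x * p y) := hcb x y
      _ ≤ cb * (r * r) := by
        have := apply_nonneg p x
        gcongr
      _ = r * cb * r := by ring
      _ ≤ 1 * r := by
        gcongr
        linarith
      _ = r := one_mul r
  have h𝔳S : 𝔳.toSubmodule = Submodule.span ℝ S := by
    rw [h𝔳, RatSubgroupSL.shortSubalgebra]
    simp only [hpq]
    exact toSubmodule_lieSpan_eq_span hSlie
  have hnilp : ∀ x ∈ 𝔳, IsNilpotent (x : Matrix (Fin N) (Fin N) ℝ) := by
    intro x hx
    have hx' : x ∈ Submodule.span ℝ S := by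
      rw [← h𝔳S]
      exact hx
    exact RatSubgroupSL.isNilpotent_of_mem_span_short P hcm hcm0 hct hct0 hr0
      (by linarith) (by linarith) g hx'
  have hadnil : ∀ x ∈ 𝔳, IsNilpotent (LieAlgebra.ad ℝ (G.lieAlgebra ℝ) x) := fun x hx =>
    LieAlgebra.isNilpotent_ad_of_isNilpotent (hnilp x hx)
  -- Engel's theorem.
  have h𝔳nil : LieRing.IsNilpotent 𝔳 :=
    (LieAlgebra.isNilpotent_iff_forall (R := ℝ)).2 fun x =>
      𝔳.isNilpotent_ad_of_isNilpotent_ad (hadnil x x.2)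
  -- the lattice in the orthogonal complement
  have hWS : W = (killingForm ℝ (G.lieAlgebra ℝ)).orthogonal (Submodule.span ℝ S) := by
    rw [hW, h𝔳S, killingPerp]
  have hbg := RatSubgroupSL.span_map_basis_eq_latticeAt b hb g
  -- The Killing form is invariant under the automorphism `Ad g`, so the Gram matrix and its
  -- determinant are the same for all `g`. This makes `C₁` uniform.
  have hMg : ∀ i j, killingForm ℝ (G.lieAlgebra ℝ) (b.map (G.adEquiv g).toLinearEquiv i)
      (b.map (G.adEquiv g).toLinearEquiv j) = Matrix.of M i j := by
    intro i j
    rw [Matrix.of_apply, ← hM i j]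
    exact LieAlgebra.killingForm_of_equiv_apply (G.adEquiv g) (b i) (b j)
  have hTp : T = {x | x ∈ Λ ∧ x ∈ W ∧ p x ≤ C / r} := by
    rw [hT, hδinv]
    simp only [hpq]
  have hclos : AddSubgroup.closure T = Λ ⊓ W.toAddSubgroup := by
    refine le_antisymm ((AddSubgroup.closure_le _).2 ?_) ?_
    · rw [hTp]
      exact fun x hx => ⟨hx.1, hx.2.1⟩
    · have h1 := hC₁ (b.map (G.adEquiv g).toLinearEquiv) (Matrix.of M) hMg rfl Λ hbg r hr0
      rw [← hWS] at h1
      refine h1.trans (AddSubgroup.closure_mono ?_)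
      rw [hTp]
      exact fun x hx => ⟨hx.1, hx.2.1, hx.2.2.trans (by gcongr)⟩
  have hTW : T ⊆ W := by
    rw [hTp]
    exact fun x hx => hx.2.1
  have hspan : Submodule.span ℝ T = W := by
    refine le_antisymm (Submodule.span_le.2 hTW) ?_
    have h1 := orthogonal_span_le_span (b.map (G.adEquiv g).toLinearEquiv)
      (killingForm ℝ (G.lieAlgebra ℝ)) (fun i j => ⟨_, hMg i j⟩) S
      (by rw [hbg]; exact fun x hx => hx.1)
    rw [← hWS, hbg] at h1
    refine h1.trans (Submodule.span_le.2 fun x hx => ?_)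
    have h2 : x ∈ AddSubgroup.closure T := by
      rw [hclos]
      exact hx
    have h3 : AddSubgroup.closure T ≤ (Submodule.span ℝ T).toAddSubgroup :=
      (AddSubgroup.closure_le _).2 Submodule.subset_span
    exact h3 h2
  refine ⟨⟨h𝔳nil, hnilp⟩, ⟨hspan, hclos⟩, ?_, ?_⟩
  · obtain ⟨v, hvL, hv0, hvδ⟩ := hv
    rw [hpq] at hvδ
    have hv0' : G.Ad g v ≠ 0 := by
      rw [RatSubgroupSL.Ad_apply_eq]
      intro h
      exact hv0 ((G.adEquiv g).injective (h.trans (map_zero _).symm))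
    have hAr : 1 ≤ A / r := by
      rw [le_div_iff₀ hr0]
      linarith
    rw [h𝔭, ← hspan]
    -- The sets track the growth of lengths: depth `j` brackets with `Ad g v` are lattice vectors of
    -- length at most `(A / r) ^ j * δ`.
    refine lieSpan_ne_top_of_forall_lie_mem 𝔳 T hv0'
      (fun j => {x | x ∈ Λ ∧ p x ≤ (A / r) ^ j * δ}) ⟨⟨v, hvL, rfl⟩, by simpa using hvδ⟩ ?_ ?_
    · rintro j t ht u ⟨hu, huj⟩
      rw [hTp] at ht
      refine ⟨RatSubgroupSL.lie_mem_latticeAt ht.1 hu, ?_⟩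
      have hCA : cb * (C / r) ≤ A / r := by
        rw [← mul_div_assoc]
        gcongr
        simp only [A]
        linarith
      calc p ⁅t, u⁆ ≤ cb * (p t * p u) := hcb t u
        _ ≤ cb * (C / r * ((A / r) ^ j * δ)) := by
          have h1 := ht.2.2
          have h2 := apply_nonneg p t
          have h3 := apply_nonneg p u
          gcongr
        _ = cb * (C / r) * ((A / r) ^ j * δ) := by ring
        _ ≤ A / r * ((A / r) ^ j * δ) := by gcongr
        _ = _ := by rw [pow_succ]; ring
    · rintro j hj u ⟨hu, huj⟩
      -- Of the `n + 2` factors `r` in the bound for `δ`, `n` cancel the denominators, one absorbs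
      -- `A ^ n`, and the last remains as the bound.
      have hur : p u ≤ r := by
        calc p u ≤ (A / r) ^ j * δ := huj
          _ ≤ (A / r) ^ n * r ^ (n + 2) := by
            gcongr
          _ = r * A ^ n * r := by
            rw [div_pow, pow_add]
            field_simp
          _ ≤ 1 * r := by
            gcongr
            linarith
          _ = r := one_mul r
      have : u ∈ 𝔳.toSubmodule := by
        rw [h𝔳S]
        exact Submodule.subset_span ⟨hu, hur⟩
      exact this
  · refine isParabolicSubalgebra_of_killingPerp_le 𝔳 hadnil 𝔭 ?_
    rw [← hW, h𝔭]
    exact LieSubalgebra.subset_lieSpan
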